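/- **Connecting Lemma.** All logarithms are natural. Let $D$ be a digraph with vertex set $V(D)$. For $x\in V(D)$ and $Y\subseteq V(D)$ let $N^+(x,Y)$ and $N^-(x,Y)$ be the sets of out-neighbours and of in-neighbours of $x$ in $Y$, and let $d^{\pm}(x,Y)=\min\{|N^+(x,Y)|,|N^-(x,Y)|\}$. Let $e(X,Y)$ be the number of arcs $(x,y)$ with $x\in X$, $y\in Y$, and $e(X)=e(X,X)$. A digraph $D$ on $n$ vertices is *$(n,\alpha,p)$-pseudorandom* if - (P1) $d^{\pm}(v,V(D))\ge(\tfrac12+2\alpha)np$ for every $v\in V(D)$; - (P2) $e(X)\le |X|\log^{2.1}n$ for every $X\subseteq V(D)$ with $|X|\le \frac{\log^2 n}{p}$; - (P3) $e(X,Y)\le(1+\tfrac{\alpha}{2})|X||Y|p$ for all disjoint $X,Y\subseteq V(D)$ with $|X|,|Y|\ge\frac{\log^{1.1}n}{p}$. For $\sigma\in\{+,-\}^{\ell}$, a *$\sigma$-walk* connecting $v_1$ to $v_{\ell+1}$ is a sequence $v_1,\dots,v_{\ell+1}$ of vertices with $v_{i+1}\in N^{\sigma(i)}(v_i,V(D))$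 for all $1\le i\le\ell$, in which all vertices are different, except that $v_1$ and $v_{\ell+1}$ may coincide. Several $\sigma$-walks are *internally disjoint* if no interior vertex of one of them lies on another. Let $\alpha>0$ be a constant, let $p=p(n)=\omega\!\left(\frac{\log^8 n}{n}\right)$, and let $f$ be a function with $f(n)\to\infty$ as $n\to\infty$. Then there is $n_0$, depending only on $\alpha$ and on the functions $p$ and $f$, such that the following holds for every $n\ge n_0$ and every $(n,\alpha,p)$-pseudorandom digraph $D$. Let $\ell$ and $t$ be integers with $\ell\ge 10\log n$ and $t\ge\frac{4\log^2 n}{p}$, and let $(a_1,b_1),\dots,(a_t,b_t)$ be pairs of vertices of $D$ with $a_i\ne a_j$ and $b_i\neq b_j$ for all $i\neq j$ (coincidences $a_i=b_j$, also with $i=j$, are allowed). Let $K\subseteq V(D)\setminus\bigcup_{i=1}^t\{a_i,b_i\}$ be such that - (i) $|K|\ge f(n)\,t\,\ell$ (that is, $|K|=\omega(t\ell)$), - (ii) $d^{\pm}(v,K)\ge(\tfrac12+\alpha)p|K|$ for every $v\in K$, and - (iii) $d^{\pm}(a_i,K),\,d^{\pm}(b_i,K)\ge(\tfrac12+\alpha)p|K|$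 for every $i\in\{1,\dots,t\}$. Then for every $\sigma\in\{+,-\}^{\ell}$ there exist $t$ internally disjoint $\sigma$-walks $P_1,\dots,P_t$ such that, for each $i$, $P_i$ connects $a_i$ to $b_i$ and $V(P_i)\setminus\{a_i,b_i\}\subseteq K$. -/

import Mathlib

open Filter

namespace Digraph

variable {V : Type*}

/-- A sign is a `Bool`: `true` stands for `+` and `false` for `-`.
`D.SignAdj τ x y` says that `y` is an out-neighbour (`τ = +`), respectively an in-neighbour
(`τ = -`), of `x`. -/
def SignAdj (D : Digraph V) (τ : Bool) (x y : V) : Prop :=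
  if τ then D.Adj x y else D.Adj y x

open Classical in
/-- `N^τ(x, Y)`: the out-neighbours or in-neighbours of `x` in `Y`. -/
noncomputable def signNbhd (D : Digraph V) (τ : Bool) (x : V) (Y : Finset V) : Finset V :=
  Y.filter fun y => D.SignAdj τ x y

/-- `d^±(x, Y)`: the minimum of the out-degree and the in-degree of `x` into `Y`. -/
noncomputable def minSemidegInto (D : Digraph V) (x : V) (Y : Finset V) : ℕ :=
  min (D.signNbhd true x Y).card (D.signNbhd false x Y).card

open Classical in
/-- `e(X, Y)`: the number of arcs going from `X` to `Y`. -/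
noncomputable def arcCount (D : Digraph V) (X Y : Finset V) : ℕ :=
  ((X ×ˢ Y).filter fun q => D.Adj q.1 q.2).card

/-- `(n, α, p)`-pseudorandom digraphs. -/
structure IsPseudorandom [Fintype V] (D : Digraph V) (n : ℕ) (α p : ℝ) : Prop where
  card_eq : Fintype.card V = n
  min_semideg : ∀ v : V,
    (1 / 2 + 2 * α) * n * p ≤ (D.minSemidegInto v Finset.univ : ℝ)
  few_arcs_within : ∀ X : Finset V, (X.card : ℝ) ≤ Real.log n ^ 2 / p →
    (D.arcCount X X : ℝ) ≤ X.card * Real.log n ^ (2.1 : ℝ)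
  arcs_between : ∀ X Y : Finset V, Disjoint X Y →
    Real.log n ^ (1.1 : ℝ) / p ≤ X.card → Real.log n ^ (1.1 : ℝ) / p ≤ Y.card →
    (D.arcCount X Y : ℝ) ≤ (1 + α / 2) * X.card * Y.card * p

/-- `w 0, …, w ℓ` is a `σ`-walk: consecutive vertices are joined by arcs directed according to
`σ`, and all the vertices are different, except that the first and the last may coincide. -/
structure IsSignWalk (D : Digraph V) {ℓ : ℕ} (σ : Fin ℓ → Bool) (w : Fin (ℓ + 1) → V) :
    Prop where
  adj : ∀ i : Fin ℓ, D.SignAdj (σ i) (w i.castSucc) (w i.succ)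
  eq_or_ends : ∀ i j : Fin (ℓ + 1), i < j → w i = w j → i = 0 ∧ j = Fin.last ℓ

end Digraph

/-- Walks `P i` are internally disjoint: an interior vertex of one of them lies on no other. -/
def InternallyDisjointWalks {V : Type*} {t ℓ : ℕ} (P : Fin t → Fin (ℓ + 1) → V) : Prop :=
  ∀ i j : Fin t, i ≠ j → ∀ k m : Fin (ℓ + 1), k ≠ 0 → k ≠ Fin.last ℓ → P i k ≠ P j m

/-! Split `K` at random into `K₁` and `K₂` so that all large neighbourhoods are halved almost evenly
(`exists_split`). By Hall's theorem each `a i` and each `b i` gets its own star of `s` leaves in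
`K₁`, all these stars being disjoint (`exists_stars`). With `ℓ = N + 2`, it remains to join, for
every `i`, some leaf at `a i` to some leaf at `b i` by a path with `N` arcs, so that the interiors
are disjoint subsets of `K₂`. This asks for disjoint representatives of `t` hypergraphs with edges
of size at most `N + 1`. Haxell's theorem reduces it to the following: for every nonempty set `A` of
indices and every `U` of size at most `2 (N + 1) (|A| - 1)`, some `i ∈ A` can be joined avoiding `U`
(`exists_connecting_interior`).

For this, enlarge `U` to a set `W`, at most twice as large, such that every vertex outside `W` has
few neighbours in `W` (`exists_absorbing`). By sparsity, vertices with many neighbours in `W` are so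
rare that fewer than half of the stars on each side consist of them alone; hence some `i ∈ A` has a
good leaf at both ends. From two good leaves (`exists_connecting_path`), a greedy path uses up the
surplus length, then the reachable sets double until they have size at least `m`. One further step
from each side reaches more than `k / 2` vertices, because semidegrees exceed `(1/2 + 3α/4) p k`
while pairs of large sets have density at most `(1 + α/2) p`. Two such sets inside at most `k`
vertices meet.

The counting principle behind most steps is `card_lt_of_deg`: few vertices can send many arcs into a
small set. -/

namespace Digraph

/-! ### Arc counting in locally sparse digraphs. -/

section Sparse

variable {V : Type*} {D : Digraph V}

theorem mem_signNbhd {τ : Bool} {x y : V} {Y : Finset V} :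
    y ∈ D.signNbhd τ x Y ↔ y ∈ Y ∧ D.SignAdj τ x y := by
  simp [signNbhd]

theorem signAdj_not {τ : Bool} {x y : V} : D.SignAdj (!τ) x y ↔ D.SignAdj τ y x := by
  cases τ <;> simp [SignAdj]

theorem signNbhd_subset (τ : Bool) (x : V) (Y : Finset V) : D.signNbhd τ x Y ⊆ Y := by
  intro y hy; exact (mem_signNbhd.1 hy).1

theorem signNbhd_mono (τ : Bool) (x : V) {Y Z : Finset V} (h : Y ⊆ Z) :
    D.signNbhd τ x Y ⊆ D.signNbhd τ x Z := by
  intro y hy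
  rw [mem_signNbhd] at hy ⊢
  exact ⟨h hy.1, hy.2⟩

theorem minSemidegInto_le (τ : Bool) (x : V) (Y : Finset V) :
    D.minSemidegInto x Y ≤ (D.signNbhd τ x Y).card := by
  cases τ
  · exact min_le_right _ _
  · exact min_le_left _ _

theorem card_signNbhd_union_le [DecidableEq V] (τ : Bool) (x : V) (Y Z : Finset V) :
    (D.signNbhd τ x (Y ∪ Z)).card ≤ (D.signNbhd τ x Y).card + (D.signNbhd τ x Z).card := by
  refine le_trans (Finset.card_le_card ?_) (Finset.card_union_le _ _)
  intro y hy
  simp only [mem_signNbhd, Finset.mem_union] at hy ⊢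
  tauto

/-- The number of pairs `(x, y)` with `x ∈ X` and `y ∈ N^τ(x, Y)`. -/
noncomputable def signArcs (D : Digraph V) (τ : Bool) (X Y : Finset V) : ℕ :=
  ∑ x ∈ X, (D.signNbhd τ x Y).card

theorem signArcs_true (X Y : Finset V) : D.signArcs true X Y = D.arcCount X Y := by
  classical
  unfold signArcs arcCount
  rw [← Finset.card_sigma]
  refine Finset.card_bij (fun q _ => (q.1, q.2)) ?_ ?_ ?_
  · rintro ⟨x, y⟩ h
    simpa [mem_signNbhd, SignAdj, and_assoc] using h
  · rintro ⟨x, y⟩ _ ⟨x', y'⟩ _ h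
    simpa using h
  · rintro ⟨x, y⟩ h
    exact ⟨⟨x, y⟩, by simpa [mem_signNbhd, SignAdj, and_assoc] using h, rfl⟩

theorem signArcs_false (X Y : Finset V) : D.signArcs false X Y = D.arcCount Y X := by
  classical
  unfold signArcs arcCount
  rw [← Finset.card_sigma]
  refine Finset.card_bij (fun q _ => (q.2, q.1)) ?_ ?_ ?_
  · rintro ⟨x, y⟩ h
    simp only [Finset.mem_sigma, mem_signNbhd, SignAdj, Finset.mem_filter,
      Finset.mem_product] at h ⊢
    simp at h
    tauto
  · rintro ⟨x, y⟩ _ ⟨x', y'⟩ _ h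
    simp at h ⊢
    tauto
  · rintro ⟨x, y⟩ h
    refine ⟨⟨y, x⟩, ?_, rfl⟩
    simp only [Finset.mem_sigma, mem_signNbhd, SignAdj, Finset.mem_filter,
      Finset.mem_product] at h ⊢
    simp
    tauto

theorem signArcs_union_le [DecidableEq V] (τ : Bool) (X Y Z : Finset V) :
    D.signArcs τ X (Y ∪ Z) ≤ D.signArcs τ X Y + D.signArcs τ X Z := by
  unfold signArcs
  rw [← Finset.sum_add_distrib]
  exact Finset.sum_le_sum fun x _ => card_signNbhd_union_le τ x Y Z

theorem signArcs_mono (τ : Bool) {X X' Y Y' : Finset V} (hX : X ⊆ X') (hY : Y ⊆ Y') :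
    D.signArcs τ X Y ≤ D.signArcs τ X' Y' :=
  (Finset.sum_le_sum fun x _ => Finset.card_le_card (signNbhd_mono τ x hY)).trans
    (Finset.sum_le_sum_of_subset hX)

theorem le_signArcs {τ : Bool} {X Y : Finset V} {d : ℝ}
    (h : ∀ x ∈ X, d ≤ ((D.signNbhd τ x Y).card : ℝ)) :
    X.card * d ≤ (D.signArcs τ X Y : ℝ) := by
  unfold signArcs
  push_cast
  simpa using Finset.card_nsmul_le_sum X _ d h

/-- Few arcs inside small sets, and no dense pairs of large sets. -/
structure LocallySparse (D : Digraph V) (α p Λ m q : ℝ) : Prop where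
  α_pos : 0 < α
  p_pos : 0 < p
  Λ_pos : 0 < Λ
  one_le_m : 1 ≤ m
  m_le_q : 16 * m ≤ q
  within : ∀ X : Finset V, (X.card : ℝ) ≤ q → (D.arcCount X X : ℝ) ≤ X.card * Λ
  between : ∀ X Y : Finset V, Disjoint X Y → m ≤ X.card → m ≤ Y.card →
    (D.arcCount X Y : ℝ) ≤ (1 + α / 2) * X.card * Y.card * p

namespace LocallySparse

variable {α p Λ m q : ℝ}

theorem signArcs_self (h : D.LocallySparse α p Λ m q) (τ : Bool) {X : Finset V}
    (hX : (X.card : ℝ) ≤ q) : (D.signArcs τ X X : ℝ) ≤ X.card * Λ := by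
  cases τ
  · rw [signArcs_false]; exact h.within X hX
  · rw [signArcs_true]; exact h.within X hX

theorem signArcs_disjoint (h : D.LocallySparse α p Λ m q) (τ : Bool) {X Y : Finset V}
    (hd : Disjoint X Y) (hX : m ≤ X.card) (hY : m ≤ Y.card) :
    (D.signArcs τ X Y : ℝ) ≤ (1 + α / 2) * p * X.card * Y.card := by
  cases τ
  · rw [signArcs_false]
    refine (h.between Y X hd.symm hY hX).trans (le_of_eq (by ring))
  · rw [signArcs_true]
    refine (h.between X Y hd hX hY).trans (le_of_eq (by ring))

theorem signArcs_le_of_add_le [DecidableEq V] (h : D.LocallySparse α p Λ m q) (τ : Bool)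
    {X Y : Finset V} (hXY : (X.card + Y.card : ℝ) ≤ q) :
    (D.signArcs τ X Y : ℝ) ≤ (X.card + Y.card) * Λ := by
  have hc : ((X ∪ Y).card : ℝ) ≤ X.card + Y.card := by exact_mod_cast Finset.card_union_le X Y
  have h1 := h.signArcs_self τ (hc.trans hXY)
  have h2 : (D.signArcs τ X Y : ℝ) ≤ D.signArcs τ (X ∪ Y) (X ∪ Y) := by
    exact_mod_cast signArcs_mono τ Finset.subset_union_left Finset.subset_union_right
  have := mul_le_mul_of_nonneg_right hc h.Λ_pos.le
  linarith

/-- Arcs inside `X` cost at most `Λ |X|`. Arcs to `Y \ X` obey the density bound if `Y \ X` has at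
least `m` vertices; otherwise `X` together with `Y \ X` has fewer than `2 |X| ≤ q` vertices up to
constants already allowed by `16 m ≤ q`, and local sparsity costs at most `2 Λ |X|` more. -/
theorem signArcs_le_of_large [DecidableEq V] (h : D.LocallySparse α p Λ m q) (τ : Bool)
    {X Y : Finset V} (hX : m ≤ X.card) (hX' : (X.card : ℝ) ≤ 4 * m) :
    (D.signArcs τ X Y : ℝ) ≤ 3 * Λ * X.card + (1 + α / 2) * p * X.card * Y.card := by
  have hα := h.α_pos
  have hp := h.p_pos
  have hΛ := h.Λ_pos
  have hm := h.one_le_m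
  have hq := h.m_le_q
  have h0 : (D.signArcs τ X Y : ℝ) ≤ D.signArcs τ X X + D.signArcs τ X (Y \ X) := by
    have h1 : D.signArcs τ X Y ≤ D.signArcs τ X (X ∪ (Y \ X)) :=
      signArcs_mono τ (Finset.Subset.refl X) (by intro y hy; simp [hy])
    exact_mod_cast h1.trans (signArcs_union_le τ X X (Y \ X))
  have h1 := h.signArcs_self τ (X := X) (by linarith)
  have hc : ((Y \ X).card : ℝ) ≤ Y.card := by
    exact_mod_cast Finset.card_le_card Finset.sdiff_subset
  rcases le_or_gt m ((Y \ X).card : ℝ) with hY | hY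
  · have h2 := h.signArcs_disjoint τ Finset.disjoint_sdiff hX hY
    have h3 : (1 + α / 2) * p * X.card * (Y \ X).card ≤ (1 + α / 2) * p * X.card * Y.card := by
      gcongr
    have : 0 ≤ X.card * Λ := by positivity
    linarith
  · have h2 := h.signArcs_le_of_add_le τ (X := X) (Y := Y \ X) (by linarith)
    have h3 : (X.card + (Y \ X).card : ℝ) * Λ ≤ (X.card + X.card) * Λ := by
      exact mul_le_mul_of_nonneg_right (by linarith) hΛ.le
    have : 0 ≤ (1 + α / 2) * p * X.card * Y.card := by positivity
    linarith

/-- Cut `Y` into blocks of size `⌈m⌉`, so that `X` and one block fit into a locally sparse set. Each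
full block costs at most `2 ⌈m⌉ Λ`, that is, `2 Λ` per vertex; `Λ |X|` is paid only once, for the
last block. -/
theorem signArcs_le_of_small [DecidableEq V] (h : D.LocallySparse α p Λ m q) (τ : Bool)
    {X : Finset V} (hX : (X.card : ℝ) ≤ m) (Y : Finset V) :
    (D.signArcs τ X Y : ℝ) ≤ Λ * (X.card + 2 * Y.card) := by
  have hΛ := h.Λ_pos
  have hm := h.one_le_m
  have hq := h.m_le_q
  have hc1 : (⌈m⌉₊ : ℝ) < m + 1 := Nat.ceil_lt_add_one (by linarith)
  have hc2 : m ≤ (⌈m⌉₊ : ℝ) := Nat.le_ceil m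
  generalize hN : Y.card = N
  induction N using Nat.strong_induction_on generalizing Y with
  | _ N ih =>
  rcases le_or_gt N ⌈m⌉₊ with hle | hlt
  · have hle' : (Y.card : ℝ) ≤ ⌈m⌉₊ := by rw [hN]; exact_mod_cast hle
    have := h.signArcs_le_of_add_le τ (X := X) (Y := Y) (by linarith)
    rw [hN] at this
    have h0 : 0 ≤ Λ * N := by positivity
    linarith
  · obtain ⟨Z, hZY, hZ⟩ := Finset.exists_subset_card_eq (s := Y) (n := ⌈m⌉₊) (by omega)
    have hcard : (Y \ Z).card = N - ⌈m⌉₊ := by rw [Finset.card_sdiff_of_subset hZY, hN, hZ]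
    have hpos : 0 < ⌈m⌉₊ := by
      have : (0 : ℝ) < ⌈m⌉₊ := by linarith
      exact_mod_cast this
    have h1 := ih (N - ⌈m⌉₊) (by omega) (Y \ Z) hcard
    have h2 := h.signArcs_le_of_add_le τ (X := X) (Y := Z) (by rw [hZ]; linarith)
    have h3 : (D.signArcs τ X Y : ℝ) ≤ D.signArcs τ X Z + D.signArcs τ X (Y \ Z) := by
      have h1 : D.signArcs τ X Y ≤ D.signArcs τ X (Z ∪ (Y \ Z)) :=
        signArcs_mono τ (Finset.Subset.refl X) (by intro y hy; simp [hy])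
      exact_mod_cast h1.trans (signArcs_union_le τ X Z (Y \ Z))
    have h4 : ((N - ⌈m⌉₊ : ℕ) : ℝ) = N - ⌈m⌉₊ := by rw [Nat.cast_sub hlt.le]
    rw [h4] at h1
    rw [hZ] at h2
    have h5 : (X.card + ⌈m⌉₊ : ℝ) * Λ ≤ (⌈m⌉₊ + ⌈m⌉₊) * Λ :=
      mul_le_mul_of_nonneg_right (by linarith) hΛ.le
    linarith

/-- Vertices sending many arcs of a fixed sign into a small set are few. -/
theorem card_lt_of_deg [DecidableEq V] (h : D.LocallySparse α p Λ m q) {τ : Bool}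
    {X Y : Finset V} {d : ℝ} (hd : ∀ x ∈ X, d ≤ ((D.signNbhd τ x Y).card : ℝ))
    (h1 : 8 * Λ ≤ d) (h2 : 4 * (1 + α / 2) * p * Y.card ≤ d) :
    (X.card : ℝ) < m ∧ d * X.card ≤ 4 * Λ * Y.card := by
  have hΛ := h.Λ_pos
  have hm := h.one_le_m
  have hXm : (X.card : ℝ) < m := by
    by_contra! hge
    obtain ⟨Z, hZX, hZ⟩ := Finset.exists_subset_card_eq (s := X) (n := ⌈m⌉₊)
      (Nat.ceil_le.2 hge)
    have hc1 : (⌈m⌉₊ : ℝ) < m + 1 := Nat.ceil_lt_add_one (by linarith)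
    have hc2 : m ≤ (⌈m⌉₊ : ℝ) := Nat.le_ceil m
    -- Averaging over `Z` gives `d ≤ 3 Λ + (1 + α/2) p |Y| ≤ 3d/8 + d/4`, which is absurd.
    have h3 := h.signArcs_le_of_large τ (X := Z) (Y := Y) (by rw [hZ]; exact hc2)
      (by rw [hZ]; linarith)
    have h4 := le_signArcs (τ := τ) (X := Z) (Y := Y) (d := d) (fun x hx => hd x (hZX hx))
    have h5 : (0 : ℝ) < Z.card := by rw [hZ]; linarith
    have h6 : (Z.card : ℝ) * d ≤ Z.card * (3 * Λ + (1 + α / 2) * p * Y.card) := by linarith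
    have h7 := le_of_mul_le_mul_left h6 h5
    linarith
  refine ⟨hXm, ?_⟩
  have h3 := h.signArcs_le_of_small τ hXm.le Y
  have h4 := le_signArcs hd
  -- The term `Λ |X|` of the upper bound is absorbed into half of `d |X|`.
  have h5 : (X.card : ℝ) * (2 * Λ) ≤ X.card * d := by gcongr; linarith
  linarith

theorem card_le_of_deg [DecidableEq V] (h : D.LocallySparse α p Λ m q)
    {X Y : Finset V} {d : ℝ} (hd : ∀ x ∈ X, ∃ τ, d ≤ ((D.signNbhd τ x Y).card : ℝ))
    (h1 : 8 * Λ ≤ d) (h2 : 4 * (1 + α / 2) * p * Y.card ≤ d) :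
    d * X.card ≤ 8 * Λ * Y.card := by
  classical
  have hs : ∀ τ : Bool, d * (X.filter fun x => d ≤ ((D.signNbhd τ x Y).card : ℝ)).card
      ≤ 4 * Λ * Y.card := fun τ =>
    (h.card_lt_of_deg (τ := τ) (fun x hx => (Finset.mem_filter.1 hx).2) h1 h2).2
  have hsub : X ⊆ (X.filter fun x => d ≤ ((D.signNbhd true x Y).card : ℝ)) ∪
      (X.filter fun x => d ≤ ((D.signNbhd false x Y).card : ℝ)) := by
    intro x hx
    obtain ⟨τ, hτ⟩ := hd x hx
    cases τ <;> simp [hx, hτ]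
  have hc : (X.card : ℝ) ≤ (X.filter fun x => d ≤ ((D.signNbhd true x Y).card : ℝ)).card +
      (X.filter fun x => d ≤ ((D.signNbhd false x Y).card : ℝ)).card := by
    exact_mod_cast (Finset.card_le_card hsub).trans (Finset.card_union_le _ _)
  have hΛ := h.Λ_pos
  have := mul_le_mul_of_nonneg_left hc (show (0 : ℝ) ≤ d by linarith)
  linarith [hs true, hs false]

/-- Any set `U` that is not too large lies in a set `W`, at most twice as large, into which no
vertex outside `W` has many neighbours. -/
theorem exists_absorbing [Fintype V] [DecidableEq V] (h : D.LocallySparse α p Λ m q)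
    (U : Finset V) {d : ℝ} (h1 : 16 * Λ ≤ d)
    (h2 : 4 * (1 + α / 2) * p * (2 * U.card + 1) ≤ d) :
    ∃ W : Finset V, U ⊆ W ∧ W.card ≤ 2 * U.card ∧
      ∀ v ∉ W, ∀ τ, ((D.signNbhd τ v W).card : ℝ) < d := by
  classical
  have hα := h.α_pos
  have hp := h.p_pos
  have hΛ := h.Λ_pos
  -- A member of maximal size works. Sparsity improves the bound `2 |U| + 1` to `2 |U|`, so the
  -- extra `1` leaves room to insert an offending vertex and contradict maximality.
  let F : Finset (Finset V) := Finset.univ.filter fun W => U ⊆ W ∧ W.card ≤ 2 * U.card + 1 ∧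
    ∀ v ∈ W \ U, ∃ τ, d ≤ ((D.signNbhd τ v W).card : ℝ)
  have hF : F.Nonempty := ⟨U, Finset.mem_filter.2
    ⟨Finset.mem_univ _, Finset.Subset.refl U, by omega, by simp⟩⟩
  obtain ⟨W, hWF, hmax⟩ := Finset.exists_max_image F Finset.card hF
  obtain ⟨hUW, hWc, hWd⟩ := (Finset.mem_filter.1 hWF).2
  have hWc' : (W.card : ℝ) ≤ 2 * U.card + 1 := by exact_mod_cast hWc
  have h3 := h.card_le_of_deg hWd (by linarith) (by
    refine le_trans ?_ h2
    gcongr)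
  have h4 : ((W \ U).card : ℝ) = W.card - U.card := by
    rw [Finset.card_sdiff_of_subset hUW, Nat.cast_sub (Finset.card_le_card hUW)]
  have h5 : 8 * Λ * W.card ≤ d / 2 * W.card := by gcongr; linarith
  have hd : 0 < d := by linarith
  have h6 : (W.card : ℝ) ≤ 2 * U.card := by
    rw [h4] at h3
    by_contra! hlt
    have : 0 < d * (W.card - 2 * U.card) := mul_pos hd (by linarith)
    linarith
  have h6' : W.card ≤ 2 * U.card := by exact_mod_cast h6
  refine ⟨W, hUW, h6', fun v hv τ => ?_⟩
  by_contra! hge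
  have hmem : insert v W ∈ F := by
    simp only [F, Finset.mem_filter, Finset.mem_univ, true_and]
    refine ⟨hUW.trans (Finset.subset_insert _ _), ?_, ?_⟩
    · rw [Finset.card_insert_of_notMem hv]; omega
    · intro u hu
      have hmono : ∀ τ, ((D.signNbhd τ u W).card : ℝ) ≤ (D.signNbhd τ u (insert v W)).card :=
        fun τ => by
          exact_mod_cast Finset.card_le_card (signNbhd_mono τ u (Finset.subset_insert v W))
      rcases Finset.mem_insert.1 (Finset.mem_sdiff.1 hu).1 with rfl | huW
      · exact ⟨τ, hge.trans (hmono τ)⟩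
      · obtain ⟨τ', hτ'⟩ := hWd u (Finset.mem_sdiff.2 ⟨huW, (Finset.mem_sdiff.1 hu).2⟩)
        exact ⟨τ', hτ'.trans (hmono τ')⟩
  have := hmax _ hmem
  rw [Finset.card_insert_of_notMem hv] at this
  omega

end LocallySparse

end Sparse

end Digraph

/-! ### Haxell's theorem on disjoint representatives. -/

section Haxell

variable {ι V : Type*} [DecidableEq ι] [DecidableEq V]

/-- One augmentation step: some index of `A` gets an edge avoiding `U` and all the
representatives, after a change of the representatives of indices outside `A`. -/
theorem exists_free_edge (H : ι → Set (Finset V)) (r : ℕ) (hr : ∀ i, ∀ E ∈ H i, E.card ≤ r)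
    (hH : ∀ A : Finset ι, A.Nonempty → ∀ U : Finset V, U.card ≤ 2 * r * (A.card - 1) →
      ∃ i ∈ A, ∃ E ∈ H i, Disjoint E U)
    (J : Finset ι) (N : ℕ) : ∀ (A : Finset ι) (U : Finset V) (g : ι → Finset V),
      (J \ A).card = N → A.Nonempty → U.card ≤ 2 * r * (A.card - 1) →
      (∀ i ∈ J, g i ∈ H i) → (∀ i ∈ J, ∀ j ∈ J, i ≠ j → Disjoint (g i) (g j)) →
      (∀ i ∈ J, i ∈ A → g i ⊆ U) → (∀ i ∈ J, i ∉ A → Disjoint (g i) U) →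
      ∃ i ∈ A, ∃ E ∈ H i, ∃ g' : ι → Finset V, (∀ i ∈ J, g' i ∈ H i) ∧
        (∀ i ∈ J, ∀ j ∈ J, i ≠ j → Disjoint (g' i) (g' j)) ∧
        (∀ i ∈ A, g' i = g i) ∧ (∀ i ∈ J, i ∉ A → Disjoint (g' i) U) ∧
        Disjoint E U ∧ ∀ j ∈ J, Disjoint E (g' j) := by
  induction N using Nat.strong_induction_on with
  | _ N ihN =>
  intro A U g hN hA hU
  obtain ⟨i, hiA, E, hE, hEU⟩ := hH A hA U hU
  -- The edge `E` stays fixed during the inner induction on the number of representatives that block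
  -- it. The outer induction is on the number of indices of `J` outside `A`.
  generalize hM : ((J \ A).filter fun j => ¬ Disjoint E (g j)).card = M
  induction M using Nat.strong_induction_on generalizing g with
  | _ M ihM =>
  intro hg hgd hgA hgU
  set B := (J \ A).filter fun j => ¬ Disjoint E (g j) with hB
  have memB : ∀ j, j ∈ B ↔ (j ∈ J ∧ j ∉ A) ∧ ¬ Disjoint E (g j) := fun j => by simp [hB]
  rcases B.eq_empty_or_nonempty with hBe | hBne
  · refine ⟨i, hiA, E, hE, g, hg, hgd, fun _ _ => rfl, hgU, hEU, fun j hj => ?_⟩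
    by_cases hjA : j ∈ A
    · exact Finset.disjoint_of_subset_right (hgA j hj hjA) hEU
    · by_contra hd
      have : j ∈ B := (memB j).2 ⟨⟨hj, hjA⟩, hd⟩
      simp [hBe] at this
  · have hAB : Disjoint A B := by
      rw [Finset.disjoint_left]
      intro j hjA hjB
      exact ((memB j).1 hjB).1.2 hjA
    have hcardAB : (A ∪ B).card = A.card + B.card := Finset.card_union_of_disjoint hAB
    have hApos := hA.card_pos
    have hBpos := hBne.card_pos
    have hJ : (J \ (A ∪ B)).card < N := by
      rw [← hN]
      refine Finset.card_lt_card ⟨?_, ?_⟩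
      · exact Finset.sdiff_subset_sdiff (Finset.Subset.refl J) Finset.subset_union_left
      · intro hsub
        obtain ⟨j, hj⟩ := hBne
        have := hsub (Finset.mem_sdiff.2 ((memB j).1 hj).1)
        simp [hj] at this
    -- The new vertices number at most `r + r |B| ≤ 2 r |B|`, as `B` is nonempty; this is where the
    -- factor `2` comes from.
    have hUcard : (U ∪ E ∪ B.biUnion g).card ≤ 2 * r * ((A ∪ B).card - 1) := by
      have h1 : (B.biUnion g).card ≤ B.card * r :=
        Finset.card_biUnion_le_card_mul _ _ _ fun j hj => hr j _ (hg j ((memB j).1 hj).1.1)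
      have h2 := Finset.card_union_le (U ∪ E) (B.biUnion g)
      have h3 := Finset.card_union_le U E
      have h4 := hr i E hE
      rw [hcardAB]
      obtain ⟨a, ha⟩ : ∃ a, A.card = a + 1 := ⟨A.card - 1, by omega⟩
      obtain ⟨b, hb⟩ : ∃ b, B.card = b + 1 := ⟨B.card - 1, by omega⟩
      rw [ha] at hU ⊢
      rw [hb] at h1 ⊢
      have h5 : a + 1 + (b + 1) - 1 = a + b + 1 := by omega
      rw [h5]
      simp only [Nat.add_sub_cancel] at hU
      nlinarith [Nat.zero_le (r * b)]
    obtain ⟨i', hi', E', hE', g', hg', hgd', hgA', hgU', hEU', hEg'⟩ :=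
      ihN _ hJ (A ∪ B) (U ∪ E ∪ B.biUnion g) g rfl (hA.mono Finset.subset_union_left) hUcard hg
        hgd
        (fun j hj hjAB => by
          rcases Finset.mem_union.1 hjAB with h | h
          · exact (hgA j hj h).trans (Finset.subset_union_left.trans Finset.subset_union_left)
          · exact (Finset.subset_biUnion_of_mem g h).trans Finset.subset_union_right)
        (fun j hj hjAB => by
          rw [Finset.mem_union, not_or] at hjAB
          simp only [Finset.disjoint_union_right, Finset.disjoint_biUnion_right]
          refine ⟨⟨hgU j hj hjAB.1, ?_⟩, fun b hb => hgd j hj b ((memB b).1 hb).1.1 ?_⟩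
          · by_contra hd
            exact hjAB.2 ((memB j).2 ⟨⟨hj, hjAB.1⟩, fun h => hd h.symm⟩)
          · rintro rfl
            exact hjAB.2 hb)
    have hUE' : Disjoint E' U ∧ Disjoint E' E := by
      simp only [Finset.disjoint_union_right] at hEU'
      exact hEU'.1
    have hout : ∀ j ∈ J, j ∉ A → Disjoint (g' j) U := by
      intro j hj hjA
      by_cases hjB : j ∈ B
      · rw [hgA' j (Finset.mem_union_right _ hjB)]
        exact hgU j hj hjA
      · have := hgU' j hj (by simp [hjA, hjB])
        simp only [Finset.disjoint_union_right] at this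
        exact this.1.1
    rcases Finset.mem_union.1 hi' with hiA' | hiB'
    · exact ⟨i', hiA', E', hE', g', hg', hgd',
        fun j hj => hgA' j (Finset.mem_union_left _ hj), hout, hUE'.1, hEg'⟩
    · have hi'A : i' ∉ A := ((memB i').1 hiB').1.2
      -- Giving `i'` the edge `E'`, which avoids `E`, removes one blocker and creates none:
      -- representatives outside `A ∪ B` also avoid `E`.
      have key := ihM (((J \ A).filter fun j => ¬ Disjoint E (Function.update g' i' E' j)).card)
        (by
          rw [← hM]
          refine Finset.card_lt_card ⟨?_, ?_⟩
          · intro j hj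
            simp only [Finset.mem_filter, Finset.mem_sdiff] at hj
            by_cases hji : j = i'
            · rw [hji]; exact hiB'
            · rw [Function.update_of_ne hji] at hj
              by_contra hjB
              have := hgU' j hj.1.1 (by simp [hj.1.2, hjB])
              simp only [Finset.disjoint_union_right] at this
              exact hj.2 this.1.2.symm
          · intro hsub
            have := hsub hiB'
            simp only [Finset.mem_filter, Function.update_self] at this
            exact this.2 hUE'.2.symm)
        (Function.update g' i' E') rfl
        (fun j hj => by
          by_cases hji : j = i'
          · subst hji; simpa using hE'
          · rw [Function.update_of_ne hji]; exact hg' j hj)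
        (fun j hj k hk hjk => by
          by_cases hji : j = i'
          · subst hji
            rw [Function.update_self, Function.update_of_ne (Ne.symm hjk)]
            exact hEg' k hk
          · by_cases hki : k = i'
            · subst hki
              rw [Function.update_self, Function.update_of_ne hji]
              exact (hEg' j hj).symm
            · rw [Function.update_of_ne hji, Function.update_of_ne hki]
              exact hgd' j hj k hk hjk)
        (fun j hj hjA => by
          have hji : j ≠ i' := fun h => hi'A (h ▸ hjA)
          rw [Function.update_of_ne hji, hgA' j (Finset.mem_union_left _ hjA)]
          exact hgA j hj hjA)
        (fun j hj hjA => by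
          by_cases hji : j = i'
          · subst hji; simpa using hUE'.1
          · rw [Function.update_of_ne hji]; exact hout j hj hjA)
      obtain ⟨i₂, hi₂, E₂, hE₂, g₂, h1, h2, h3, h4, h5, h6⟩ := key
      refine ⟨i₂, hi₂, E₂, hE₂, g₂, h1, h2, fun j hj => ?_, h4, h5, h6⟩
      have hji : j ≠ i' := fun h => hi'A (h ▸ hj)
      rw [h3 j hj, Function.update_of_ne hji, hgA' j (Finset.mem_union_left _ hj)]

/-- **Haxell's theorem** (in a slightly weakened form): a family of hypergraphs with edges of
size at most `r` has a system of disjoint representatives if no subfamily `A` is covered by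
`2 * r * (#A - 1)` vertices. -/
theorem exists_disjoint_representatives [Fintype ι] (H : ι → Set (Finset V)) (r : ℕ)
    (hr : ∀ i, ∀ E ∈ H i, E.card ≤ r)
    (hH : ∀ A : Finset ι, A.Nonempty → ∀ U : Finset V, U.card ≤ 2 * r * (A.card - 1) →
      ∃ i ∈ A, ∃ E ∈ H i, Disjoint E U) :
    ∃ g : ι → Finset V, (∀ i, g i ∈ H i) ∧ ∀ i j, i ≠ j → Disjoint (g i) (g j) := by
  suffices h : ∀ J : Finset ι, ∃ g : ι → Finset V, (∀ i ∈ J, g i ∈ H i) ∧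
      ∀ i ∈ J, ∀ j ∈ J, i ≠ j → Disjoint (g i) (g j) by
    obtain ⟨g, h1, h2⟩ := h Finset.univ
    exact ⟨g, fun i => h1 i (Finset.mem_univ i),
      fun i j => h2 i (Finset.mem_univ i) j (Finset.mem_univ j)⟩
  intro J
  induction J using Finset.induction_on with
  | empty => exact ⟨fun _ => ∅, by simp, by simp⟩
  | insert a J ha ih =>
    obtain ⟨g, hg, hgd⟩ := ih
    obtain ⟨i, hi, E, hE, g', hg', hgd', -, -, -, hEg⟩ :=
      exists_free_edge H r hr hH J _ {a} ∅ g rfl (Finset.singleton_nonempty a) (by simp) hg hgd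
        (fun i hi hia => by
          rw [Finset.mem_singleton] at hia
          exact absurd (hia ▸ hi) ha)
        (fun _ _ _ => Finset.disjoint_empty_right _)
    rw [Finset.mem_singleton] at hi
    subst hi
    have hne : ∀ j ∈ J, j ≠ i := fun j hj h => ha (h ▸ hj)
    refine ⟨Function.update g' i E, ?_, ?_⟩
    · intro j hj
      rcases Finset.mem_insert.1 hj with rfl | hj
      · simpa using hE
      · rw [Function.update_of_ne (hne j hj)]; exact hg' j hj
    · intro j hj k hk hjk
      rcases Finset.mem_insert.1 hj with hj' | hj' <;>
        rcases Finset.mem_insert.1 hk with hk' | hk'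
      · exact absurd (hj'.trans hk'.symm) hjk
      · rw [hj', Function.update_self, Function.update_of_ne (hne k hk')]; exact hEg k hk'
      · rw [hk', Function.update_self, Function.update_of_ne (hne j hj')]
        exact (hEg j hj').symm
      · rw [Function.update_of_ne (hne j hj'), Function.update_of_ne (hne k hk')]
        exact hgd' j hj' k hk' hjk

end Haxell

namespace Digraph

/-! ### Paths with prescribed signs and length between two vertices. -/

section Paths

variable {V : Type*} {D : Digraph V}

/-- `v` can be reached from `x` by a path with `j` arcs, directed according to `τ`, inside `T`. -/
def SignPathIn (D : Digraph V) (τ : ℕ → Bool) (x : V) (j : ℕ) (v : V) (T : Finset V) : Prop :=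
  ∃ w : ℕ → V, w 0 = x ∧ w j = v ∧ (∀ i < j, D.SignAdj (τ i) (w i) (w (i + 1))) ∧
    (∀ i ≤ j, ∀ i' ≤ j, w i = w i' → i = i') ∧ ∀ i ≤ j, w i ∈ T

theorem SignPathIn.mono {τ : ℕ → Bool} {x v : V} {j : ℕ} {T T' : Finset V}
    (h : D.SignPathIn τ x j v T) (hT : T ⊆ T') : D.SignPathIn τ x j v T' := by
  obtain ⟨w, h0, hj, hadj, hinj, hmem⟩ := h
  exact ⟨w, h0, hj, hadj, hinj, fun i hi => hT (hmem i hi)⟩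

theorem signPathIn_zero (τ : ℕ → Bool) (x : V) : D.SignPathIn τ x 0 x {x} :=
  ⟨fun _ => x, rfl, rfl, by simp, by intro i hi i' hi' _; omega, by simp⟩

theorem SignPathIn.extend [DecidableEq V] {τ : ℕ → Bool} {x v v' : V} {j : ℕ} {T : Finset V}
    (h : D.SignPathIn τ x j v T) (hv : D.SignAdj (τ j) v v') (hv' : v' ∉ T) :
    D.SignPathIn τ x (j + 1) v' (insert v' T) := by
  obtain ⟨w, h0, hj, hadj, hinj, hmem⟩ := h
  have hne : ∀ i ≤ j, Function.update w (j + 1) v' i = w i := fun i hi =>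
    Function.update_of_ne (by omega) _ _
  refine ⟨Function.update w (j + 1) v', ?_, by simp, ?_, ?_, ?_⟩
  · rw [hne 0 (by omega), h0]
  · intro i hi
    rcases Nat.lt_or_ge i j with hij | hij
    · rw [hne i hij.le, hne (i + 1) hij]; exact hadj i hij
    · obtain rfl : i = j := by omega
      rw [hne i le_rfl, Function.update_self, hj]; exact hv
  · intro i hi i' hi' heq
    rcases Nat.lt_or_ge j i with hij | hij <;> rcases Nat.lt_or_ge j i' with hij' | hij'
    · omega
    · obtain rfl : i = j + 1 := by omega
      rw [hne i' hij', Function.update_self] at heq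
      exact absurd (heq ▸ hmem i' hij') hv'
    · obtain rfl : i' = j + 1 := by omega
      rw [hne i hij, Function.update_self] at heq
      exact absurd (heq ▸ hmem i hij) hv'
    · rw [hne i hij, hne i' hij'] at heq
      exact hinj i hij i' hij' heq
  · intro i hi
    rcases Nat.lt_or_ge j i with hij | hij
    · obtain rfl : i = j + 1 := by omega
      simp
    · rw [hne i hij]; exact Finset.mem_insert_of_mem (hmem i hij)

/-- The second path is traversed backwards, so its signs must be the remaining signs of `τ` in
reverse order and negated. -/
theorem SignPathIn.join [DecidableEq V] {τ τ' : ℕ → Bool} {x y z : V} {M N : ℕ}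
    {A B : Finset V} (h : D.SignPathIn τ x M z (insert z A))
    (h' : D.SignPathIn τ' y N z (insert z B)) (hAB : Disjoint A B) (hzB : z ∉ B)
    (hτ : ∀ i < N, τ' i = !τ (M + N - 1 - i)) :
    D.SignPathIn τ x (M + N) y (insert z (A ∪ B)) := by
  obtain ⟨w, h0, hM, hadj, hinj, hmem⟩ := h
  obtain ⟨w', h0', hN, hadj', hinj', hmem'⟩ := h'
  have hB : ∀ i < N, w' i ∈ B := by
    intro i hi
    rcases Finset.mem_insert.1 (hmem' i hi.le) with h | h
    · have := hinj' i hi.le N le_rfl (h.trans hN.symm); omega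
    · exact h
  have hcross : ∀ i ≤ M, ∀ i' < N, w i ≠ w' i' := by
    intro i hi i' hi' heq
    have h1 := hB i' hi'
    rw [← heq] at h1
    rcases Finset.mem_insert.1 (hmem i hi) with h | h
    · exact hzB (h ▸ h1)
    · exact Finset.disjoint_left.1 hAB h h1
  refine ⟨fun i => if i ≤ M then w i else w' (M + N - i), by simp [h0], ?_, ?_, ?_, ?_⟩
  · rcases Nat.eq_zero_or_pos N with rfl | hN0
    · simp [hM, ← hN, h0']
    · have : ¬ M + N ≤ M := by omega
      simp only [this, if_false]
      simpa using h0'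
  · intro i hi
    rcases Nat.lt_or_ge i M with hiM | hiM
    · simp only [hiM.le, if_true, Nat.succ_le_of_lt hiM]
      exact hadj i hiM
    · have h1 : (if i ≤ M then w i else w' (M + N - i)) = w' (M + N - i) := by
        split_ifs with hc
        · obtain rfl : i = M := by omega
          rw [hM, Nat.add_sub_cancel_left, hN]
        · rfl
      have h2 : ¬ i + 1 ≤ M := by omega
      simp only [h1, h2, if_false]
      have h3 := hadj' (M + N - i - 1) (by omega)
      have h4 : M + N - i - 1 + 1 = M + N - i := by omega
      have h5 : M + N - 1 - (M + N - i - 1) = i := by omega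
      have h6 : M + N - (i + 1) = M + N - i - 1 := by omega
      rw [hτ _ (by omega), h4, h5, signAdj_not] at h3
      rw [h6]
      exact h3
  · intro i hi i' hi' heq
    simp only at heq
    split_ifs at heq with h1 h2 h2
    · exact hinj i h1 i' h2 heq
    · exact absurd heq (hcross i h1 _ (by omega))
    · exact absurd heq.symm (hcross i' h2 _ (by omega))
    · have := hinj' _ (by omega) _ (by omega) heq
      omega
  · intro i hi
    simp only
    split_ifs with h1
    · have := hmem i h1
      simp only [Finset.mem_insert, Finset.mem_union] at this ⊢
      tauto
    · have := hB (M + N - i) (by omega)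
      simp [this]

/-- Greedy path of prescribed length. -/
theorem exists_signPathIn_of_deg [DecidableEq V] {S : Finset V} {x : V} {d : ℝ}
    (hd : ∀ v ∈ insert x S, ∀ τ, d ≤ ((D.signNbhd τ v S).card : ℝ)) (τ : ℕ → Bool) (g : ℕ)
    (hg : (g : ℝ) + 1 ≤ d) :
    ∃ v ∈ insert x S, ∃ T ⊆ insert x S, T.card ≤ g + 1 ∧ D.SignPathIn τ x g v T := by
  induction g with
  | zero => exact ⟨x, by simp, {x}, by simp, by simp, signPathIn_zero τ x⟩
  | succ g ih =>
    push_cast at hg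
    obtain ⟨v, hv, T, hT, hTc, hp⟩ := ih (by linarith)
    have h1 : T.card < (D.signNbhd (τ g) v S).card := by
      have := hd v hv (τ g)
      have h2 : (T.card : ℝ) ≤ g + 1 := by exact_mod_cast hTc
      have : (T.card : ℝ) < (D.signNbhd (τ g) v S).card := by linarith
      exact_mod_cast this
    obtain ⟨v', hv', hv'T⟩ := Finset.exists_mem_notMem_of_card_lt_card h1
    rw [mem_signNbhd] at hv'
    have hv'S : v' ∈ insert x S := Finset.mem_insert_of_mem hv'.1
    refine ⟨v', hv'S, insert v' T, Finset.insert_subset hv'S hT, ?_, hp.extend hv'.2 hv'T⟩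
    exact (Finset.card_insert_le _ _).trans (by omega)

namespace LocallySparse

variable {α p Λ m q : ℝ}

/-- Otherwise all neighbours of `X` in `S` lie in a set of fewer than `8 |X|` vertices, and
`card_lt_of_deg` gives `d |X| ≤ 32 Λ |X|`, against `48 Λ ≤ d`. -/
theorem exists_double [DecidableEq V] (h : D.LocallySparse α p Λ m q) {S R X : Finset V}
    {τ : Bool} {d : ℝ} (hd : ∀ v ∈ X, d ≤ ((D.signNbhd τ v S).card : ℝ)) (hX : X.Nonempty)
    (hXm : (X.card : ℝ) ≤ m) (hR : R.card ≤ 6 * X.card) (h1 : 48 * Λ ≤ d)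
    (h2 : 4 * (1 + α / 2) * p * (8 * m) ≤ d) :
    ∃ Y ⊆ S \ R, Y.card = 2 * X.card ∧ ∀ v ∈ Y, ∃ u ∈ X, D.SignAdj τ u v := by
  have hα := h.α_pos
  have hp := h.p_pos
  have hΛ := h.Λ_pos
  set Y := (X.biUnion fun x => D.signNbhd τ x S) \ R with hY
  have hYS : Y ⊆ S \ R :=
    Finset.sdiff_subset_sdiff (Finset.biUnion_subset.2 fun x _ => signNbhd_subset τ x S)
      (Finset.Subset.refl R)
  have hYadj : ∀ v ∈ Y, ∃ u ∈ X, D.SignAdj τ u v := by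
    intro v hv
    obtain ⟨u, hu, hv⟩ := Finset.mem_biUnion.1 (Finset.mem_sdiff.1 hv).1
    exact ⟨u, hu, (mem_signNbhd.1 hv).2⟩
  rcases le_or_gt (2 * X.card) Y.card with hle | hlt
  · obtain ⟨Z, hZY, hZ⟩ := Finset.exists_subset_card_eq hle
    exact ⟨Z, hZY.trans hYS, hZ, fun v hv => hYadj v (hZY hv)⟩
  · exfalso
    have hc : (Y ∪ R).card ≤ 8 * X.card := (Finset.card_union_le _ _).trans (by omega)
    have hc' : ((Y ∪ R).card : ℝ) ≤ 8 * X.card := by exact_mod_cast hc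
    have h3 := (h.card_lt_of_deg (τ := τ) (X := X) (Y := Y ∪ R) (d := d) (fun x hx => by
      refine (hd x hx).trans ?_
      exact_mod_cast Finset.card_le_card fun y hy => by
        rw [mem_signNbhd]
        refine ⟨?_, (mem_signNbhd.1 hy).2⟩
        by_cases hyR : y ∈ R
        · exact Finset.mem_union_right _ hyR
        · exact Finset.mem_union_left _
            (Finset.mem_sdiff.2 ⟨Finset.mem_biUnion.2 ⟨x, hx, hy⟩, hyR⟩))
      (by linarith) (by
        refine le_trans ?_ h2
        gcongr
        linarith)).2
    have hXpos : (0 : ℝ) < X.card := by exact_mod_cast hX.card_pos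
    have h4 : 4 * Λ * (Y ∪ R).card ≤ 4 * Λ * (8 * X.card) := by gcongr
    have h5 : 48 * Λ * X.card ≤ d * X.card := by gcongr
    nlinarith [mul_pos hΛ hXpos]

/-- If at most `k / 2` new vertices were reached, the density bound would allow an average degree of
at most `3 Λ + (1 + α/2) p (k/2 + 8m)`. Its excess over `p k / 2` consists of three terms, each at
most `α p k / 4` and the first one strictly smaller. -/
theorem exists_majority [DecidableEq V] (h : D.LocallySparse α p Λ m q) {S R X : Finset V}
    {τ : Bool} {k : ℝ}
    (hd : ∀ v ∈ X, (1 / 2 + 3 * α / 4) * p * k ≤ ((D.signNbhd τ v S).card : ℝ))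
    (hX : m ≤ X.card) (hXm : (X.card : ℝ) ≤ 4 * m) (hR : (R.card : ℝ) ≤ 8 * m)
    (h1 : 12 * Λ < α * p * k) (h2 : 32 * (1 + α / 2) * m ≤ α * k) :
    ∃ Y ⊆ S \ R, k / 2 < Y.card ∧ ∀ v ∈ Y, ∃ u ∈ X, D.SignAdj τ u v := by
  have hα := h.α_pos
  have hp := h.p_pos
  have hΛ := h.Λ_pos
  have hm := h.one_le_m
  set Y := (X.biUnion fun x => D.signNbhd τ x S) \ R with hY
  have hYS : Y ⊆ S \ R :=
    Finset.sdiff_subset_sdiff (Finset.biUnion_subset.2 fun x _ => signNbhd_subset τ x S)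
      (Finset.Subset.refl R)
  refine ⟨Y, hYS, ?_, ?_⟩
  · by_contra! hle
    have h3 := h.signArcs_le_of_large τ (Y := Y ∪ R) hX hXm
    have h4 := le_signArcs (τ := τ) (X := X) (Y := Y ∪ R)
      (d := (1 / 2 + 3 * α / 4) * p * k) (fun x hx => by
      refine (hd x hx).trans ?_
      exact_mod_cast Finset.card_le_card fun y hy => by
        rw [mem_signNbhd]
        refine ⟨?_, (mem_signNbhd.1 hy).2⟩
        by_cases hyR : y ∈ R
        · exact Finset.mem_union_right _ hyR
        · exact Finset.mem_union_left _
            (Finset.mem_sdiff.2 ⟨Finset.mem_biUnion.2 ⟨x, hx, hy⟩, hyR⟩))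
    have hXpos : (0 : ℝ) < X.card := by linarith
    have h5 : (X.card : ℝ) * ((1 / 2 + 3 * α / 4) * p * k) ≤
        X.card * (3 * Λ + (1 + α / 2) * p * (Y ∪ R).card) := by linarith
    have h6 := le_of_mul_le_mul_left h5 hXpos
    have hc : ((Y ∪ R).card : ℝ) ≤ k / 2 + 8 * m := by
      have : ((Y ∪ R).card : ℝ) ≤ Y.card + R.card := by exact_mod_cast Finset.card_union_le Y R
      linarith
    have h7 : (1 + α / 2) * p * (Y ∪ R).card ≤ (1 + α / 2) * p * (k / 2 + 8 * m) := by gcongr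
    have h8 : p * (32 * (1 + α / 2) * m) ≤ p * (α * k) := by gcongr
    nlinarith
  · intro v hv
    obtain ⟨u, hu, hv⟩ := Finset.mem_biUnion.1 (Finset.mem_sdiff.1 hv).1
    exact ⟨u, hu, (mem_signNbhd.1 hv).2⟩

/-- Disjoint layers of `2 ^ j` vertices reachable from `x` and from `y`. -/
theorem exists_layers [DecidableEq V] (h : D.LocallySparse α p Λ m q) {S Ta Tb : Finset V}
    {x y va vb : V} {τ τ' : ℕ → Bool} {g : ℕ} {d : ℝ}
    (hd : ∀ v, v = va ∨ v = vb ∨ v ∈ S → ∀ τ, d ≤ ((D.signNbhd τ v S).card : ℝ))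
    (hTa : Disjoint Ta S) (hTb : Disjoint Tb S)
    (ha : D.SignPathIn τ x g va Ta) (hb : D.SignPathIn τ' y 0 vb Tb)
    (h1 : 48 * Λ ≤ d) (h2 : 4 * (1 + α / 2) * p * (8 * m) ≤ d) (j : ℕ)
    (hj : ∀ i < j, (2 : ℝ) ^ i ≤ m) :
    ∃ La Lb Ra Rb : Finset V, La.card = 2 ^ j ∧ Lb.card = 2 ^ j ∧
      (∀ v ∈ La, v = va ∨ v = vb ∨ v ∈ S) ∧ (∀ v ∈ Lb, v = va ∨ v = vb ∨ v ∈ S) ∧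
      Ra ⊆ S ∧ Rb ⊆ S ∧ Disjoint Ra Rb ∧ Ra.card ≤ 2 * 2 ^ j ∧ Rb.card ≤ 2 * 2 ^ j ∧
      (∀ v ∈ La, D.SignPathIn τ x (g + j) v (Ta ∪ Ra)) ∧
      (∀ v ∈ Lb, D.SignPathIn τ' y j v (Tb ∪ Rb)) := by
  induction j with
  | zero =>
    refine ⟨{va}, {vb}, ∅, ∅, by simp, by simp, by simp, by simp, by simp, by simp, by simp,
      by simp, by simp, ?_, ?_⟩
    · simpa using ha
    · simpa using hb
  | succ j ih =>
    obtain ⟨La, Lb, Ra, Rb, hLac, hLbc, hLa, hLb, hRa, hRb, hRab, hRac, hRbc, hpa, hpb⟩ :=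
      ih fun i hi => hj i (by omega)
    have hjm := hj j (by omega)
    have hpos : 0 < 2 ^ j := by positivity
    obtain ⟨Xa, hXa, hXac, hXaadj⟩ := h.exists_double (S := S) (R := Ra ∪ Rb) (X := La)
      (τ := τ (g + j)) (fun v hv => hd v (hLa v hv) _) (Finset.card_pos.1 (by omega))
      (by rw [hLac]; push_cast; exact hjm)
      ((Finset.card_union_le _ _).trans (by omega)) h1 h2
    have hRac' : (Ra ∪ Xa).card ≤ 2 * 2 ^ (j + 1) :=
      (Finset.card_union_le _ _).trans (by rw [pow_succ]; omega)
    -- The `y`-side must also avoid the layer just added on the `x`-side; the forbidden set then has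
    -- up to `6 * 2 ^ j` vertices, the limit in `exists_double`.
    obtain ⟨Xb, hXb, hXbc, hXbadj⟩ := h.exists_double (S := S) (R := (Ra ∪ Xa) ∪ Rb) (X := Lb)
      (τ := τ' j) (fun v hv => hd v (hLb v hv) _) (Finset.card_pos.1 (by omega))
      (by rw [hLbc]; push_cast; exact hjm)
      ((Finset.card_union_le _ _).trans (by rw [pow_succ] at hRac'; omega)) h1 h2
    have hXaS : ∀ v ∈ Xa, v ∈ S ∧ v ∉ Ra ∧ v ∉ Rb := fun v hv => by
      have := hXa hv
      simp only [Finset.mem_sdiff, Finset.mem_union] at this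
      tauto
    have hXbS : ∀ v ∈ Xb, v ∈ S ∧ v ∉ Ra ∧ v ∉ Xa ∧ v ∉ Rb := fun v hv => by
      have := hXb hv
      simp only [Finset.mem_sdiff, Finset.mem_union] at this
      tauto
    refine ⟨Xa, Xb, Ra ∪ Xa, Rb ∪ Xb, by rw [hXac, hLac, pow_succ, mul_comm],
      by rw [hXbc, hLbc, pow_succ, mul_comm], fun v hv => Or.inr (Or.inr (hXaS v hv).1),
      fun v hv => Or.inr (Or.inr (hXbS v hv).1),
      Finset.union_subset hRa fun v hv => (hXaS v hv).1,
      Finset.union_subset hRb fun v hv => (hXbS v hv).1, ?_, hRac',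
      (Finset.card_union_le _ _).trans (by rw [pow_succ]; omega), ?_, ?_⟩
    · rw [Finset.disjoint_left]
      intro v hv hv'
      rcases Finset.mem_union.1 hv with hv | hv <;> rcases Finset.mem_union.1 hv' with hv' | hv'
      · exact Finset.disjoint_left.1 hRab hv hv'
      · exact (hXbS v hv').2.1 hv
      · exact (hXaS v hv).2.2 hv'
      · exact (hXbS v hv').2.2.1 hv
    · intro v hv
      obtain ⟨u, hu, huv⟩ := hXaadj v hv
      refine ((hpa u hu).extend huv ?_).mono ?_
      · rw [Finset.mem_union, not_or]
        exact ⟨fun hvT => Finset.disjoint_left.1 hTa hvT (hXaS v hv).1, (hXaS v hv).2.1⟩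
      · intro w hw
        simp only [Finset.mem_insert, Finset.mem_union] at hw ⊢
        rcases hw with rfl | hw | hw <;> tauto
    · intro v hv
      obtain ⟨u, hu, huv⟩ := hXbadj v hv
      refine ((hpb u hu).extend huv ?_).mono ?_
      · rw [Finset.mem_union, not_or]
        exact ⟨fun hvT => Finset.disjoint_left.1 hTb hvT (hXbS v hv).1, (hXbS v hv).2.2.2⟩
      · intro w hw
        simp only [Finset.mem_insert, Finset.mem_union] at hw ⊢
        rcases hw with rfl | hw | hw <;> tauto

/-- Two vertices of large semidegree into `S` are joined by a path of any sign pattern of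
admissible length with interior in `S`. -/
theorem exists_connecting_path [DecidableEq V] (h : D.LocallySparse α p Λ m q)
    {S : Finset V} {x y : V} {k : ℝ} (hxy : x ≠ y) (hyS : y ∉ S)
    (hSk : (S.card : ℝ) ≤ k)
    (hd : ∀ v, v = x ∨ v = y ∨ v ∈ S → ∀ τ,
      (1 / 2 + 13 * α / 16) * p * k ≤ ((D.signNbhd τ v S).card : ℝ))
    (h1 : 96 * Λ ≤ p * k) (h1' : 12 * Λ < α * p * k) (h2 : 64 * (1 + α / 2) * m ≤ k)
    (h2' : 32 * (1 + α / 2) * m ≤ α * k)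
    {s N : ℕ} (hs : ∀ i < s, (2 : ℝ) ^ i ≤ m) (hs' : m ≤ (2 : ℝ) ^ s)
    (hsN : 2 * s + 2 ≤ N) (hN : (N : ℝ) + 1 ≤ p * k / 2) (hN' : (N : ℝ) + 1 ≤ α / 16 * p * k)
    (τ : ℕ → Bool) : D.SignPathIn τ x N y (insert x (insert y S)) := by
  have hα := h.α_pos
  have hp := h.p_pos
  have hΛ := h.Λ_pos
  have hm := h.one_le_m
  have hpk : 0 < p * k := by linarith
  have hαpk : 0 < α * (p * k) := by positivity
  -- The `x`-side has `g` greedy arcs, `s` doublings and one majority step; the `y`-side has `s`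
  -- doublings and one majority step.
  obtain ⟨g, rfl⟩ : ∃ g, N = (g + s + 1) + (s + 1) := ⟨N - (2 * s + 2), by omega⟩
  push_cast at hN hN'
  have hs0 : (0 : ℝ) ≤ s := Nat.cast_nonneg s
  obtain ⟨va, hva, T, hT, hTc, hpT⟩ := exists_signPathIn_of_deg (D := D) (S := S) (x := x)
    (d := (1 / 2 + 13 * α / 16) * p * k)
    (fun v hv τ => hd v (by rw [Finset.mem_insert] at hv; tauto) τ) τ g
    (by nlinarith)
  have hyT : y ∉ T := fun hy => by
    rcases Finset.mem_insert.1 (hT hy) with h | h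
    · exact hxy h.symm
    · exact hyS h
  have hTc' : (T.card : ℝ) ≤ g + 1 := by exact_mod_cast hTc
  -- Deleting the greedy path costs at most `g + 1 ≤ α p k / 16` in degree, so `13α/16` drops to
  -- `3α/4`.
  have hd' : ∀ v, v = va ∨ v = y ∨ v ∈ S \ T → ∀ τ,
      (1 / 2 + 3 * α / 4) * p * k ≤ ((D.signNbhd τ v (S \ T)).card : ℝ) := by
    intro v hv τ
    have hv' : v = x ∨ v = y ∨ v ∈ S := by
      rcases hv with rfl | rfl | hv
      · rw [Finset.mem_insert] at hva; tauto
      · tauto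
      · exact Or.inr (Or.inr (Finset.mem_sdiff.1 hv).1)
    have h3 := hd v hv' τ
    have h4 : ((D.signNbhd τ v S).card : ℝ) ≤ (D.signNbhd τ v (S \ T)).card + T.card := by
      have : (D.signNbhd τ v S).card ≤ (D.signNbhd τ v (S \ T)).card + T.card := by
        refine le_trans (Finset.card_le_card ?_) (Finset.card_union_le _ _)
        intro u hu
        simp only [mem_signNbhd, Finset.mem_union, Finset.mem_sdiff] at hu ⊢
        tauto
      exact_mod_cast this
    nlinarith
  set τ' : ℕ → Bool := fun i => !τ ((g + s + 1) + (s + 1) - 1 - i) with hτ'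
  obtain ⟨La, Lb, Ra, Rb, hLac, hLbc, hLa, hLb, hRa, hRb, hRab, hRac, hRbc, hpa, hpb⟩ :=
    h.exists_layers (S := S \ T) (Ta := T) (Tb := {y}) (τ := τ) (τ' := τ')
      (d := p * k / 2) (fun v hv τ => le_trans (by nlinarith) (hd' v hv τ))
      Finset.disjoint_sdiff (by simp [hyS]) hpT (signPathIn_zero τ' y)
      (by linarith) (by nlinarith [mul_le_mul_of_nonneg_left h2 hp.le]) s hs
  have h2s : (2 : ℝ) ^ s ≤ 2 * m := by
    rcases Nat.eq_zero_or_pos s with rfl | hs1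
    · simp; linarith
    · obtain ⟨s', rfl⟩ : ∃ s', s = s' + 1 := ⟨s - 1, by omega⟩
      have := hs s' (by omega)
      rw [pow_succ]; linarith
  have hRc : ((Ra ∪ Rb).card : ℝ) ≤ 8 * m := by
    have : (Ra ∪ Rb).card ≤ 4 * 2 ^ s := (Finset.card_union_le _ _).trans (by omega)
    have : ((Ra ∪ Rb).card : ℝ) ≤ 4 * 2 ^ s := by exact_mod_cast this
    linarith
  have hLac' : (La.card : ℝ) = 2 ^ s := by rw [hLac]; push_cast; rfl
  have hLbc' : (Lb.card : ℝ) = 2 ^ s := by rw [hLbc]; push_cast; rfl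
  obtain ⟨Ya, hYa, hYac, hYaadj⟩ := h.exists_majority (S := S \ T) (R := Ra ∪ Rb) (X := La)
    (τ := τ (g + s)) (fun v hv => hd' v (hLa v hv) _) (by rw [hLac']; exact hs')
    (by rw [hLac']; linarith) hRc h1' h2'
  obtain ⟨Yb, hYb, hYbc, hYbadj⟩ := h.exists_majority (S := S \ T) (R := Ra ∪ Rb) (X := Lb)
    (τ := τ' s) (fun v hv => hd' v (hLb v hv) _) (by rw [hLbc']; exact hs')
    (by rw [hLbc']; linarith) hRc h1' h2'
  have hmeet : ¬ Disjoint Ya Yb := by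
    intro hdis
    have h3 : (Ya ∪ Yb).card ≤ S.card := Finset.card_le_card
      (Finset.union_subset (hYa.trans (Finset.sdiff_subset.trans Finset.sdiff_subset))
        (hYb.trans (Finset.sdiff_subset.trans Finset.sdiff_subset)))
    rw [Finset.card_union_of_disjoint hdis] at h3
    have h4 : (Ya.card + Yb.card : ℝ) ≤ S.card := by exact_mod_cast h3
    linarith
  obtain ⟨z, hza, hzb⟩ := Finset.not_disjoint_iff.1 hmeet
  obtain ⟨ua, hua, huaz⟩ := hYaadj z hza
  obtain ⟨ub, hub, hubz⟩ := hYbadj z hzb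
  have hz : (z ∈ S ∧ z ∉ T) ∧ z ∉ Ra ∧ z ∉ Rb := by
    have := hYa hza
    simp only [Finset.mem_sdiff, Finset.mem_union] at this
    tauto
  have hzy : z ≠ y := fun h => hyS (h ▸ hz.1.1)
  have hzA : z ∉ T ∪ Ra := by simp [hz]
  have hzB : z ∉ {y} ∪ Rb := by simp [hz, hzy]
  have hAB : Disjoint (T ∪ Ra) ({y} ∪ Rb) := by
    have hyRa : y ∉ Ra := fun hy => hyS (Finset.mem_sdiff.1 (hRa hy)).1
    have hTRb : Disjoint T Rb := Finset.disjoint_sdiff.mono_right hRb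
    rw [Finset.disjoint_union_left, Finset.disjoint_union_right, Finset.disjoint_union_right,
      Finset.disjoint_singleton_right, Finset.disjoint_singleton_right]
    exact ⟨⟨hyT, hTRb⟩, hyRa, hRab⟩
  refine (((hpa ua hua).extend huaz hzA).join ((hpb ub hub).extend hubz hzB) hAB hzB
    (fun i _ => rfl)).mono ?_
  intro w hw
  simp only [Finset.mem_insert, Finset.mem_union, Finset.mem_singleton] at hw ⊢
  rcases hw with rfl | (hw | hw) | hw | hw
  · exact Or.inr (Or.inr hz.1.1)
  · have := hT hw
    rw [Finset.mem_insert] at this; tauto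
  · exact Or.inr (Or.inr (Finset.mem_sdiff.1 (hRa hw)).1)
  · tauto
  · exact Or.inr (Or.inr (Finset.mem_sdiff.1 (hRb hw)).1)

end LocallySparse

end Paths

end Digraph

/-! ### Random halving of sets, and Hall's theorem for stars. -/

section Split

variable {V : Type*} [DecidableEq V]

/-- This is the moment generating function of the imbalance for a uniformly random `T ⊆ K`: it
factorises over the elements of `K`, and `cosh c ≤ exp (c ^ 2 / 2)`. -/
theorem sum_exp_imbalance_le (K N : Finset V) (hN : N ⊆ K) (c : ℝ) :
    ∑ T ∈ K.powerset, Real.exp (c * (((N ∩ T).card : ℝ) - (N \ T).card)) ≤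
      2 ^ K.card * Real.exp (c ^ 2 / 2 * N.card) := by
  have hprod := Finset.prod_add (fun x => if x ∈ N then Real.exp c else 1)
    (fun x => if x ∈ N then Real.exp (-c) else 1) K
  have hsum : ∑ T ∈ K.powerset, Real.exp (c * (((N ∩ T).card : ℝ) - (N \ T).card)) =
      ∏ x ∈ K, ((if x ∈ N then Real.exp c else 1) + if x ∈ N then Real.exp (-c) else 1) := by
    rw [hprod]
    refine Finset.sum_congr rfl fun T hT => ?_
    rw [Finset.prod_ite_mem, Finset.prod_ite_mem, Finset.prod_const, Finset.prod_const,
      ← Real.exp_nat_mul, ← Real.exp_nat_mul, ← Real.exp_add]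
    have h1 : T ∩ N = N ∩ T := Finset.inter_comm _ _
    have h2 : (K \ T) ∩ N = N \ T := by
      ext x
      simp only [Finset.mem_inter, Finset.mem_sdiff]
      exact ⟨fun h => ⟨h.2, h.1.2⟩, fun h => ⟨⟨hN h.1, h.2⟩, h.1⟩⟩
    rw [h1, h2]
    congr 1
    ring
  have hbound : ∀ x ∈ K, ((if x ∈ N then Real.exp c else 1) +
      if x ∈ N then Real.exp (-c) else 1) ≤
      2 * (if x ∈ N then Real.exp (c ^ 2 / 2) else 1) := by
    intro x _
    split_ifs
    · have h1 := Real.cosh_le_exp_half_sq c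
      rw [Real.cosh_eq] at h1
      linarith
    · norm_num
  rw [hsum]
  refine (Finset.prod_le_prod (fun x _ => ?_) hbound).trans (le_of_eq ?_)
  · split_ifs <;> positivity
  · rw [Finset.prod_mul_distrib, Finset.prod_const, Finset.prod_ite_mem, Finset.prod_const,
      ← Real.exp_nat_mul, Finset.inter_eq_right.2 hN, mul_comm (N.card : ℝ)]

/-- A set can be split so that all members of a family of large subsets are split evenly. -/
theorem exists_balanced_split {ι : Type*} [Fintype ι] (K : Finset V) (N : ι → Finset V)
    (hN : ∀ i, N i ⊆ K) {δ d : ℝ} (hδ : 0 < δ) (hd : ∀ i, d ≤ (N i).card)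
    (hι : (Fintype.card ι : ℝ) * (2 * Real.exp (-(δ ^ 2 / 2 * d))) < 1) :
    ∃ T ⊆ K, ∀ i, |((N i ∩ T).card : ℝ) - (N i \ T).card| ≤ δ * (N i).card := by
  by_contra! hbad
  set Z : ι → Finset V → ℝ := fun i T => ((N i ∩ T).card : ℝ) - (N i \ T).card with hZ
  -- Markov's inequality with exponent `δ` and a union bound, written as sums: every bad `T`
  -- contributes at least `1`, while the total is below `2 ^ |K|`.
  have h1 : ∀ T ∈ K.powerset, (1 : ℝ) ≤ ∑ i, Real.exp (-(δ ^ 2 * (N i).card)) *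
      (Real.exp (δ * Z i T) + Real.exp (-δ * Z i T)) := by
    intro T hT
    obtain ⟨i, hi⟩ := hbad T (Finset.mem_powerset.1 hT)
    refine le_trans ?_ (Finset.single_le_sum (f := fun i => Real.exp (-(δ ^ 2 * (N i).card)) *
      (Real.exp (δ * Z i T) + Real.exp (-δ * Z i T))) (fun j _ => by positivity)
      (Finset.mem_univ i))
    have h2 : Real.exp (δ ^ 2 * (N i).card) ≤ Real.exp (δ * Z i T) + Real.exp (-δ * Z i T) := by
      rcases lt_abs.1 hi with h | h
      · have : Real.exp (δ ^ 2 * (N i).card) ≤ Real.exp (δ * Z i T) := by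
          rw [Real.exp_le_exp]; nlinarith
        linarith [Real.exp_pos (-δ * Z i T)]
      · have : Real.exp (δ ^ 2 * (N i).card) ≤ Real.exp (-δ * Z i T) := by
          rw [Real.exp_le_exp]; nlinarith
        linarith [Real.exp_pos (δ * Z i T)]
    calc (1 : ℝ) = Real.exp (-(δ ^ 2 * (N i).card)) * Real.exp (δ ^ 2 * (N i).card) := by
          rw [← Real.exp_add]; simp
      _ ≤ _ := by gcongr
  have h2 := Finset.sum_le_sum h1
  rw [Finset.sum_comm] at h2
  have h3 : ∀ i ∈ Finset.univ, ∑ T ∈ K.powerset, Real.exp (-(δ ^ 2 * (N i).card)) *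
      (Real.exp (δ * Z i T) + Real.exp (-δ * Z i T)) ≤
      2 ^ K.card * (2 * Real.exp (-(δ ^ 2 / 2 * d))) := by
    intro i _
    have ha := sum_exp_imbalance_le K (N i) (hN i) δ
    have hb := sum_exp_imbalance_le K (N i) (hN i) (-δ)
    rw [← Finset.mul_sum, Finset.sum_add_distrib]
    calc Real.exp (-(δ ^ 2 * (N i).card)) *
          (∑ T ∈ K.powerset, Real.exp (δ * Z i T) + ∑ T ∈ K.powerset, Real.exp (-δ * Z i T))
        ≤ Real.exp (-(δ ^ 2 * (N i).card)) * (2 ^ K.card * Real.exp (δ ^ 2 / 2 * (N i).card) +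
          2 ^ K.card * Real.exp ((-δ) ^ 2 / 2 * (N i).card)) := by gcongr
      _ = 2 ^ K.card * (2 * (Real.exp (-(δ ^ 2 * (N i).card)) *
          Real.exp (δ ^ 2 / 2 * (N i).card))) := by rw [neg_sq]; ring
      _ = 2 ^ K.card * (2 * Real.exp (-(δ ^ 2 / 2 * (N i).card))) := by
          rw [← Real.exp_add]; congr 3; ring
      _ ≤ _ := by
          have := hd i
          gcongr
  have h4 := h2.trans (Finset.sum_le_sum h3)
  simp only [Finset.sum_const, Finset.card_powerset, nsmul_eq_mul, Finset.card_univ] at h4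
  push_cast at h4
  have h5 : (0 : ℝ) < 2 ^ K.card := by positivity
  nlinarith

/-- Hall's theorem for stars: disjoint subsets of size `s`. -/
theorem exists_disjoint_subsets {ι : Type*} [DecidableEq ι] (N : ι → Finset V) (s : ℕ)
    (h : ∀ I : Finset ι, s * I.card ≤ (I.biUnion N).card) :
    ∃ St : ι → Finset V, (∀ i, St i ⊆ N i) ∧ (∀ i, (St i).card = s) ∧
      ∀ i j, i ≠ j → Disjoint (St i) (St j) := by
  -- Each index is replaced by `s` copies of itself.
  obtain ⟨f, hf, hfN⟩ := (Finset.all_card_le_biUnion_card_iff_exists_injective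
    (fun x : ι × Fin s => N x.1)).1 (fun I => by
      have h1 : I ⊆ (I.image Prod.fst) ×ˢ (Finset.univ : Finset (Fin s)) := fun x hx =>
        Finset.mem_product.2 ⟨Finset.mem_image_of_mem _ hx, Finset.mem_univ _⟩
      have h2 := Finset.card_le_card h1
      rw [Finset.card_product, Finset.card_univ, Fintype.card_fin] at h2
      have h3 : (I.image Prod.fst).biUnion N = I.biUnion fun x => N x.1 := by
        rw [Finset.image_biUnion]
      rw [← h3]
      exact (h2.trans (le_of_eq (mul_comm _ _))).trans (h _))
  refine ⟨fun i => Finset.univ.image fun c : Fin s => f (i, c), ?_, ?_, ?_⟩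
  · intro i v hv
    obtain ⟨c, -, rfl⟩ := Finset.mem_image.1 hv
    exact hfN (i, c)
  · intro i
    rw [Finset.card_image_of_injective _ (fun c c' hcc => by simpa using hf hcc)]
    simp
  · intro i j hij
    rw [Finset.disjoint_left]
    intro v hv hv'
    obtain ⟨c, -, rfl⟩ := Finset.mem_image.1 hv
    obtain ⟨c', -, h'⟩ := Finset.mem_image.1 hv'
    have := hf h'
    simp at this
    exact hij this.1.symm

end Split

namespace Digraph

/-! ### Splitting neighbourhoods and choosing disjoint stars. -/

section Split

variable {V : Type*} {D : Digraph V}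

/-- A vertex set can be split in two halves so that large neighbourhoods are split evenly. -/
theorem exists_split [Fintype V] [DecidableEq V] (D : Digraph V) (K : Finset V) {δ d : ℝ}
    (hδ : 0 < δ) (hK : d ≤ K.card)
    (hV : (2 * Fintype.card V + 1 : ℝ) * (2 * Real.exp (-(δ ^ 2 / 2 * d))) < 1) :
    ∃ P : Bool → Finset V, (∀ c, P c ⊆ K) ∧ Disjoint (P true) (P false) ∧
      (∀ c, (1 - δ) / 2 * K.card ≤ (P c).card ∧ ((P c).card : ℝ) ≤ (1 + δ) / 2 * K.card) ∧
      ∀ c v τ, d ≤ (D.signNbhd τ v K).card →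
        (1 - δ) / 2 * (D.signNbhd τ v K).card ≤ ((D.signNbhd τ v (P c)).card : ℝ) := by
  classical
  -- The index `none` controls the sizes of the two parts. Neighbourhoods smaller than `d` are
  -- replaced by `K`, so every set in the family has size at least `d`.
  let N : Option (V × Bool) → Finset V := fun o => o.elim K fun x =>
    if d ≤ (D.signNbhd x.2 x.1 K).card then D.signNbhd x.2 x.1 K else K
  have hNK : ∀ i, N i ⊆ K := by
    rintro (_ | ⟨v, τ⟩)
    · exact Finset.Subset.refl K
    · simp only [N, Option.elim]
      split_ifs
      · exact signNbhd_subset _ _ _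
      · exact Finset.Subset.refl K
  have hNd : ∀ i, d ≤ (N i).card := by
    rintro (_ | ⟨v, τ⟩)
    · exact hK
    · simp only [N, Option.elim]
      split_ifs with h
      · exact h
      · exact hK
  obtain ⟨T, hTK, hT⟩ := exists_balanced_split K N hNK hδ hNd (by
    simp only [Fintype.card_option, Fintype.card_prod, Fintype.card_bool]
    push_cast
    rwa [mul_comm (Fintype.card V : ℝ) 2])
  have hhalf : ∀ i, (1 - δ) / 2 * (N i).card ≤ ((N i ∩ T).card : ℝ) ∧
      ((N i ∩ T).card : ℝ) ≤ (1 + δ) / 2 * (N i).card ∧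
      (1 - δ) / 2 * (N i).card ≤ ((N i \ T).card : ℝ) ∧
      ((N i \ T).card : ℝ) ≤ (1 + δ) / 2 * (N i).card := by
    intro i
    have h1 := abs_le.1 (hT i)
    have h2 : ((N i ∩ T).card : ℝ) + (N i \ T).card = (N i).card := by
      exact_mod_cast Finset.card_inter_add_card_sdiff (N i) T
    refine ⟨?_, ?_, ?_, ?_⟩ <;> linarith
  have hKT := hhalf none
  simp only [N, Option.elim, Finset.inter_eq_right.2 hTK] at hKT
  refine ⟨fun c => if c then T else K \ T, ?_, ?_, ?_, ?_⟩
  · intro c; cases c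
    · simp
    · simpa using hTK
  · simpa using Finset.disjoint_sdiff
  · intro c; cases c
    · simpa using hKT.2.2
    · simpa using ⟨hKT.1, hKT.2.1⟩
  · intro c v τ hv
    have h1 := hhalf (some (v, τ))
    simp only [N, Option.elim, hv, if_true] at h1
    cases c
    · refine h1.2.2.1.trans ?_
      exact_mod_cast Finset.card_le_card fun y hy => by
        simp only [Finset.mem_sdiff, mem_signNbhd] at hy
        simp [mem_signNbhd, hy]
    · refine h1.1.trans ?_
      exact_mod_cast Finset.card_le_card fun y hy => by
        simp only [Finset.mem_inter, mem_signNbhd] at hy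
        simp [mem_signNbhd, hy]

namespace LocallySparse

variable {α p Λ m q : ℝ}

/-- Hall's condition with a spare factor `2`: a smaller union would receive at least `d` arcs from
each `a i`, contradicting `card_lt_of_deg`. The factor lets `exists_stars` treat the two ends
separately, since some `a i` may equal some `b j`: one end accounts for at least half of `I`. -/
theorem mul_card_le_card_biUnion [DecidableEq V] (h : D.LocallySparse α p Λ m q)
    {ι : Type*} {a : ι → V} (ha : Function.Injective a)
    {τ : Bool} {K : Finset V} {d : ℝ}
    (hd : ∀ i, d ≤ ((D.signNbhd τ (a i) K).card : ℝ)) {s : ℕ} (I : Finset ι)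
    (h1 : 8 * Λ * s ≤ d) (h1' : 8 * Λ ≤ d)
    (h2 : 4 * (1 + α / 2) * p * (2 * s * I.card) ≤ d) :
    2 * s * I.card ≤ (I.biUnion fun i => D.signNbhd τ (a i) K).card := by
  by_contra! hlt
  have hα := h.α_pos
  have hp := h.p_pos
  have hΛ := h.Λ_pos
  set Y := I.biUnion fun i => D.signNbhd τ (a i) K with hY
  have hYc : (Y.card : ℝ) < 2 * s * I.card := by exact_mod_cast hlt
  have h3 := (h.card_lt_of_deg (τ := τ) (X := I.image a) (Y := Y) (d := d) (fun x hx => by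
    obtain ⟨i, hi, rfl⟩ := Finset.mem_image.1 hx
    have hsub : D.signNbhd τ (a i) K ⊆ D.signNbhd τ (a i) Y := fun y hy =>
      mem_signNbhd.2 ⟨Finset.mem_biUnion.2 ⟨i, hi, hy⟩, (mem_signNbhd.1 hy).2⟩
    exact (hd i).trans (by exact_mod_cast Finset.card_le_card hsub)) h1' (by
      refine le_trans ?_ h2
      gcongr)).2
  rw [Finset.card_image_of_injective _ ha] at h3
  have h4 : 4 * Λ * Y.card < 4 * Λ * (2 * s * I.card) := by gcongr
  have h5 : 8 * Λ * s * I.card ≤ d * I.card := by gcongr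
  linarith

/-- Disjoint stars of size `s`, one centred at each `a i` and one at each `b i`. -/
theorem exists_stars [DecidableEq V] (h : D.LocallySparse α p Λ m q) {t s : ℕ} {a b : Fin t → V}
    (ha : Function.Injective a) (hb : Function.Injective b) {τ τ' : Bool} {K : Finset V} {d : ℝ}
    (hda : ∀ i, d ≤ ((D.signNbhd τ (a i) K).card : ℝ))
    (hdb : ∀ i, d ≤ ((D.signNbhd τ' (b i) K).card : ℝ))
    (h1 : 8 * Λ * s ≤ d) (h1' : 8 * Λ ≤ d) (h2 : 8 * (1 + α / 2) * p * (s * t) ≤ d) :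
    ∃ Sa Sb : Fin t → Finset V, (∀ i, Sa i ⊆ D.signNbhd τ (a i) K) ∧
      (∀ i, Sb i ⊆ D.signNbhd τ' (b i) K) ∧ (∀ i, (Sa i).card = s) ∧ (∀ i, (Sb i).card = s) ∧
      (∀ i j, i ≠ j → Disjoint (Sa i) (Sa j)) ∧ (∀ i j, i ≠ j → Disjoint (Sb i) (Sb j)) ∧
      ∀ i j, Disjoint (Sa i) (Sb j) := by
  have hα := h.α_pos
  have hp := h.p_pos
  have hI : ∀ I : Finset (Fin t), 4 * (1 + α / 2) * p * (2 * s * I.card) ≤ d := fun I => by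
    have : (I.card : ℝ) ≤ t := by exact_mod_cast (Finset.card_le_univ I).trans_eq (by simp)
    calc 4 * (1 + α / 2) * p * (2 * s * I.card) ≤ 4 * (1 + α / 2) * p * (2 * s * t) := by gcongr
      _ = 8 * (1 + α / 2) * p * (s * t) := by ring
      _ ≤ d := h2
  obtain ⟨St, hSt, hStc, hStd⟩ := exists_disjoint_subsets
    (Sum.elim (fun i => D.signNbhd τ (a i) K) (fun i => D.signNbhd τ' (b i) K)) s (fun I => by
      have hA := h.mul_card_le_card_biUnion ha hda I.toLeft h1 h1' (hI _)
      have hB := h.mul_card_le_card_biUnion hb hdb I.toRight h1 h1' (hI _)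
      have hA' := hA.trans (Finset.card_le_card (t := I.biUnion
        (Sum.elim (fun i => D.signNbhd τ (a i) K) (fun i => D.signNbhd τ' (b i) K)))
        (fun y hy => by
          obtain ⟨i, hi, hy⟩ := Finset.mem_biUnion.1 hy
          exact Finset.mem_biUnion.2 ⟨Sum.inl i, Finset.mem_toLeft.1 hi, hy⟩))
      have hB' := hB.trans (Finset.card_le_card (t := I.biUnion
        (Sum.elim (fun i => D.signNbhd τ (a i) K) (fun i => D.signNbhd τ' (b i) K)))
        (fun y hy => by
          obtain ⟨i, hi, hy⟩ := Finset.mem_biUnion.1 hy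
          exact Finset.mem_biUnion.2 ⟨Sum.inr i, Finset.mem_toRight.1 hi, hy⟩))
      have hc := Finset.card_toLeft_add_card_toRight (u := I)
      rw [← hc]
      nlinarith)
  exact ⟨fun i => St (Sum.inl i), fun i => St (Sum.inr i), fun i => hSt (Sum.inl i),
    fun i => hSt (Sum.inr i), fun i => hStc _, fun i => hStc _,
    fun i j hij => hStd _ _ (by simpa using hij), fun i j hij => hStd _ _ (by simpa using hij),
    fun i j => hStd _ _ (by simp)⟩

end LocallySparse

end Split

end Digraph

namespace Digraph

/-! ### Connecting all pairs simultaneously. -/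

section Connecting

variable {V : Type*} {D : Digraph V}

theorem SignPathIn.exists_card_le [DecidableEq V] {τ : ℕ → Bool} {x v : V} {j : ℕ} {T : Finset V}
    (h : D.SignPathIn τ x j v T) : ∃ T' ⊆ T, T'.card ≤ j + 1 ∧ D.SignPathIn τ x j v T' := by
  obtain ⟨w, h0, hj, hadj, hinj, hmem⟩ := h
  refine ⟨(Finset.range (j + 1)).image w, ?_, Finset.card_image_le.trans (by simp),
    w, h0, hj, hadj, hinj, fun i hi => Finset.mem_image_of_mem _ (by simp; omega)⟩
  intro u hu
  obtain ⟨i, hi, rfl⟩ := Finset.mem_image.1 hu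
  exact hmem i (by simp at hi; omega)

namespace LocallySparse

variable {α p Λ m q : ℝ}

/-- Few stars consist only of vertices with many neighbours in a small set `W`. -/
theorem two_mul_card_lt_of_stars [DecidableEq V] (h : D.LocallySparse α p Λ m q) {ι : Type*}
    {St : ι → Finset V} {s : ℕ} (hs : ∀ i, (St i).card = s)
    (hdisj : ∀ i j, i ≠ j → Disjoint (St i) (St j)) {A B : Finset ι} (hA : A.Nonempty)
    {W : Finset V} {d r : ℝ}
    (hB : ∀ i ∈ B, ∀ x ∈ St i, ∃ τ, d ≤ ((D.signNbhd τ x W).card : ℝ))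
    (h1 : 8 * Λ ≤ d) (h2 : 4 * (1 + α / 2) * p * W.card ≤ d)
    (hW : (W.card : ℝ) ≤ 4 * r * A.card) (hds : 64 * Λ * r < d * s) :
    2 * B.card < A.card := by
  have hΛ := h.Λ_pos
  have h3 := h.card_le_of_deg (X := B.biUnion St) (Y := W) (d := d) (fun x hx => by
    obtain ⟨i, hi, hx⟩ := Finset.mem_biUnion.1 hx
    exact hB i hi x hx) h1 h2
  rw [Finset.card_biUnion fun i _ j _ hij => hdisj i j hij, Finset.sum_congr rfl fun i _ => hs i,
    Finset.sum_const, smul_eq_mul] at h3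
  push_cast at h3
  have hApos : (0 : ℝ) < A.card := by exact_mod_cast hA.card_pos
  have h4 : 8 * Λ * W.card ≤ 8 * Λ * (4 * r * A.card) := by gcongr
  have h5 : 64 * Λ * r * A.card < d * s * A.card := by gcongr
  -- If `d * s ≤ 0`, then `r < 0`, and the bound on `|W|` would be negative.
  have hds0 : 0 < d * s := by
    by_contra! hle
    have hr : r < 0 := by nlinarith
    have : (0 : ℝ) ≤ W.card := Nat.cast_nonneg _
    nlinarith
  have h6 : d * s * (2 * B.card) < d * s * A.card := by linarith
  have h7 := lt_of_mul_lt_mul_left h6 hds0.le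
  exact_mod_cast h7

/-- Among the pairs of stars indexed by `A`, some pair is connected by a path of given sign
pattern avoiding a prescribed set `U`. -/
theorem exists_connecting_interior [Fintype V] [DecidableEq V] (h : D.LocallySparse α p Λ m q)
    {k : ℝ} {s N r t : ℕ} {K₁ K₂ : Finset V} (hK : Disjoint K₁ K₂) (hk : (K₂.card : ℝ) ≤ k)
    (hd₂ : ∀ v ∈ K₁ ∪ K₂, ∀ τ, (1 / 2 + 7 * α / 8) * p * k ≤ ((D.signNbhd τ v K₂).card : ℝ))
    {Sa Sb : Fin t → Finset V} (hSa₁ : ∀ i, ∀ x ∈ Sa i, x ∈ K₁) (hSb₁ : ∀ i, ∀ x ∈ Sb i, x ∈ K₁)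
    (hSac : ∀ i, (Sa i).card = s) (hSbc : ∀ i, (Sb i).card = s)
    (hSad : ∀ i j, i ≠ j → Disjoint (Sa i) (Sa j)) (hSbd : ∀ i j, i ≠ j → Disjoint (Sb i) (Sb j))
    (hSab : ∀ i j, Disjoint (Sa i) (Sb j))
    (hr : ∀ i < r, (2 : ℝ) ^ i ≤ m) (hr' : m ≤ (2 : ℝ) ^ r) (hrN : 2 * r + 2 ≤ N)
    (n1 : 16 * Λ ≤ α / 16 * p * k) (n2 : 96 * Λ ≤ p * k) (n4 : 64 * (1 + α / 2) * m ≤ k)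
    (n5 : 32 * (1 + α / 2) * m ≤ α * k) (n6 : (N : ℝ) + 1 ≤ p * k / 2)
    (n7 : (N : ℝ) + 1 ≤ α / 16 * p * k)
    (n8 : 4 * (1 + α / 2) * p * (4 * (N + 1) * t + 1) ≤ α / 16 * p * k)
    (n9 : 64 * Λ * ((N : ℝ) + 1) < α / 16 * p * k * s) (σ : ℕ → Bool)
    {A : Finset (Fin t)} (hA : A.Nonempty) {U : Finset V}
    (hU : U.card ≤ 2 * (N + 1) * (A.card - 1)) :
    ∃ i ∈ A, ∃ E ∈ {E : Finset V | E ⊆ K₂ ∧ E.card ≤ N + 1 ∧ ∃ x ∈ Sa i, ∃ y ∈ Sb i,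
      D.SignPathIn (fun j => σ (j + 1)) x N y (insert x (insert y E))}, Disjoint E U := by
  have hα := h.α_pos
  have hp := h.p_pos
  have hΛ := h.Λ_pos
  set d := α / 16 * p * k with hd
  have hAt : A.card ≤ t := (Finset.card_le_univ A).trans_eq (by simp)
  have hUA : (U.card : ℝ) ≤ 2 * (N + 1) * A.card := by
    have : U.card ≤ 2 * (N + 1) * A.card := hU.trans (by gcongr; omega)
    exact_mod_cast this
  have hUt : (U.card : ℝ) ≤ 2 * (N + 1) * t := by
    refine hUA.trans ?_
    have : (A.card : ℝ) ≤ t := by exact_mod_cast hAt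
    gcongr
  obtain ⟨W, hUW, hWc, hW⟩ := h.exists_absorbing U (d := d) n1 (by
    refine le_trans (mul_le_mul_of_nonneg_left ?_ (by positivity)) n8
    linarith)
  have hWc' : (W.card : ℝ) ≤ 2 * U.card := by exact_mod_cast hWc
  have hWd : 4 * (1 + α / 2) * p * W.card ≤ d := by
    refine le_trans ?_ n8
    gcongr
    linarith
  have hWA : (W.card : ℝ) ≤ 4 * (N + 1) * A.card := by linarith
  classical
  let bad : V → Prop := fun x => ∃ τ, d ≤ ((D.signNbhd τ x W).card : ℝ)
  have hBa := h.two_mul_card_lt_of_stars hSac hSad (A := A)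
    (B := A.filter fun i => ∀ x ∈ Sa i, bad x) hA (fun i hi => (Finset.mem_filter.1 hi).2)
    (by linarith) hWd hWA n9
  have hBb := h.two_mul_card_lt_of_stars hSbc hSbd (A := A)
    (B := A.filter fun i => ∀ x ∈ Sb i, bad x) hA (fun i hi => (Finset.mem_filter.1 hi).2)
    (by linarith) hWd hWA n9
  -- Each of the two bad sets contains fewer than half of the indices in `A`.
  obtain ⟨i, hiA, hi⟩ : ∃ i ∈ A, i ∉ (A.filter fun i => ∀ x ∈ Sa i, bad x) ∪
      (A.filter fun i => ∀ x ∈ Sb i, bad x) :=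
    Finset.exists_mem_notMem_of_card_lt_card ((Finset.card_union_le _ _).trans_lt (by omega))
  simp only [Finset.mem_union, Finset.mem_filter, hiA, true_and, not_or, not_forall] at hi
  obtain ⟨⟨x, hx, hxb⟩, y, hy, hyb⟩ := hi
  have hxK := hSa₁ i x hx
  have hyK := hSb₁ i y hy
  have hpath := h.exists_connecting_path (S := K₂ \ W) (x := x) (y := y) (k := k)
    (fun hxy => Finset.disjoint_left.1 (hSab i i) hx (hxy ▸ hy))
    (fun hyS => Finset.disjoint_left.1 hK hyK (Finset.mem_sdiff.1 hyS).1)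
    (le_trans (by exact_mod_cast Finset.card_le_card Finset.sdiff_subset) hk)
    (fun v hv τ => by
      have hvK : v ∈ K₁ ∪ K₂ := by
        rcases hv with rfl | rfl | hv
        · exact Finset.mem_union_left _ hxK
        · exact Finset.mem_union_left _ hyK
        · exact Finset.mem_union_right _ (Finset.mem_sdiff.1 hv).1
      have hvW : ((D.signNbhd τ v W).card : ℝ) < d := by
        rcases hv with rfl | rfl | hv
        · exact not_le.1 fun hle => hxb ⟨τ, hle⟩
        · exact not_le.1 fun hle => hyb ⟨τ, hle⟩
        · exact hW v (Finset.mem_sdiff.1 hv).2 τ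
      -- Removing `W` costs less than `α p k / 16`, so `7α/8` drops to `13α/16`.
      have e1 := hd₂ v hvK τ
      have e2 : ((D.signNbhd τ v K₂).card : ℝ) ≤
          (D.signNbhd τ v (K₂ \ W)).card + (D.signNbhd τ v W).card := by
        have : (D.signNbhd τ v K₂).card ≤ (D.signNbhd τ v (K₂ \ W ∪ W)).card :=
          Finset.card_le_card (signNbhd_mono τ v (by simp))
        exact_mod_cast this.trans (card_signNbhd_union_le τ v _ _)
      have e3 : d = α / 16 * p * k := hd
      nlinarith)
    n2 (by nlinarith) n4 n5 hr hr' hrN n6 n7 (fun j => σ (j + 1))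
  obtain ⟨T, hT, hTc, hTp⟩ := hpath.exists_card_le
  -- The ends `x`, `y` lie in `K₁` and are left out of the hyperedge: the stars are already
  -- disjoint.
  refine ⟨i, hiA, T ∩ (K₂ \ W), ⟨?_, ?_, x, hx, y, hy, hTp.mono ?_⟩, ?_⟩
  · exact Finset.inter_subset_right.trans Finset.sdiff_subset
  · exact (Finset.card_le_card Finset.inter_subset_left).trans hTc
  · intro v hv
    have := hT hv
    simp only [Finset.mem_insert, Finset.mem_inter] at this ⊢
    tauto
  · rw [Finset.disjoint_left]
    intro v hv hvU
    exact (Finset.mem_sdiff.1 (Finset.mem_inter.1 hv).2).2 (hUW hvU)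

/-- The connecting lemma for a set of vertices that has been split into a part `K₁`, used for the
first and last steps, and a part `K₂`, used for all the others. -/
theorem exists_walks [Fintype V] [DecidableEq V] (h : D.LocallySparse α p Λ m q) {C k d₁ : ℝ}
    {s N r t : ℕ} {a b : Fin t → V} (ha : Function.Injective a) (hb : Function.Injective b)
    {K₁ K₂ : Finset V} (hK : Disjoint K₁ K₂) (hk : (K₂.card : ℝ) ≤ k)
    (hda : ∀ i τ, d₁ ≤ ((D.signNbhd τ (a i) K₁).card : ℝ))
    (hdb : ∀ i τ, d₁ ≤ ((D.signNbhd τ (b i) K₁).card : ℝ))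
    (hd₂ : ∀ v ∈ K₁ ∪ K₂, ∀ τ, (1 / 2 + 7 * α / 8) * p * k ≤ ((D.signNbhd τ v K₂).card : ℝ))
    (hs1 : 1 ≤ s) (hs : 8 * Λ * s ≤ d₁) (hst : 8 * (1 + α / 2) * p * (s * t) ≤ d₁)
    (hr : ∀ i < r, (2 : ℝ) ^ i ≤ m) (hr' : m ≤ (2 : ℝ) ^ r) (hrN : 2 * r + 2 ≤ N)
    (hC : 2000 * (1 + α) ≤ C) (hC' : 2000 * (1 + α) ≤ α * C)
    (h1 : C * Λ ≤ p * k) (h2 : C * m ≤ k) (h3 : C * (N + 1) ≤ p * k)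
    (h4 : C * ((N + 1) * t) ≤ k) (h5 : C * (Λ * (N + 1)) ≤ p * k * s) (σ : ℕ → Bool) :
    ∃ w : Fin t → ℕ → V, ∀ i, (w i 0 = a i ∧ w i (N + 2) = b i ∧
      ∀ j < N + 2, D.SignAdj (σ j) (w i j) (w i (j + 1))) ∧
      (∀ j, 0 < j → j < N + 2 → w i j ∈ K₁ ∪ K₂) ∧
      (∀ j, 0 < j → j < N + 2 → ∀ j', 0 < j' → j' < N + 2 → w i j = w i j' → j = j') ∧
      ∀ i', i ≠ i' → ∀ j, 0 < j → j < N + 2 → ∀ j', 0 < j' → j' < N + 2 → w i j ≠ w i' j' := by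
  have hα := h.α_pos
  have hp := h.p_pos
  have hΛ := h.Λ_pos
  have hm := h.one_le_m
  have hs1' : (1 : ℝ) ≤ s := by exact_mod_cast hs1
  have hC0 : 0 < C := by linarith
  have hk0 : 0 < k := lt_of_lt_of_le (by positivity) h2
  have hpk : 0 < p * k := by positivity
  obtain ⟨Sa, Sb, hSa, hSb, hSac, hSbc, hSad, hSbd, hSab⟩ := h.exists_stars ha hb
    -- The last arc is seen from `b i`, hence the negated sign.
    (τ := σ 0) (τ' := !σ (N + 1)) (K := K₁) (s := s) (fun i => hda i _) (fun i => hdb i _) hs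
    (le_trans (le_mul_of_one_le_right (by positivity) hs1') hs) hst
  have hSa₁ : ∀ i, ∀ x ∈ Sa i, x ∈ K₁ := fun i x hx => (mem_signNbhd.1 (hSa i hx)).1
  have hSb₁ : ∀ i, ∀ x ∈ Sb i, x ∈ K₁ := fun i x hx => (mem_signNbhd.1 (hSb i hx)).1
  have p1 : 0 < α * Λ := by positivity
  have p2 : 0 < α * m := by positivity
  have p3 : 0 ≤ α * (N : ℝ) := by positivity
  have n1 : 16 * Λ ≤ α / 16 * p * k := by
    have e1 : 2000 * (1 + α) * Λ ≤ α * C * Λ := by gcongr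
    have e2 : α * (C * Λ) ≤ α * (p * k) := by gcongr
    linarith
  have n2 : 96 * Λ ≤ p * k := by
    have e1 : 2000 * (1 + α) * Λ ≤ C * Λ := by gcongr
    linarith
  have n4 : 64 * (1 + α / 2) * m ≤ k := by
    have e1 : 2000 * (1 + α) * m ≤ C * m := by gcongr
    linarith
  have n5 : 32 * (1 + α / 2) * m ≤ α * k := by
    have e1 : 2000 * (1 + α) * m ≤ α * C * m := by gcongr
    have e2 : α * (C * m) ≤ α * k := by gcongr
    linarith
  have n6 : (N : ℝ) + 1 ≤ p * k / 2 := by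
    have e1 : 2000 * (1 + α) * ((N : ℝ) + 1) ≤ C * (N + 1) := by gcongr
    have : (0 : ℝ) ≤ N := Nat.cast_nonneg N
    linarith
  have n7 : (N : ℝ) + 1 ≤ α / 16 * p * k := by
    have e1 : 2000 * (1 + α) * ((N : ℝ) + 1) ≤ α * C * (N + 1) := by gcongr
    have e2 : α * (C * (N + 1)) ≤ α * (p * k) := by gcongr
    have : (0 : ℝ) ≤ N := Nat.cast_nonneg N
    linarith
  have n8 : 4 * (1 + α / 2) * p * (4 * (N + 1) * t + 1) ≤ α / 16 * p * k := by
    have e1 : 2000 * (1 + α) * (((N : ℝ) + 1) * t) ≤ α * C * ((N + 1) * t) := by gcongr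
    have e2 : α * (C * ((N + 1) * t)) ≤ α * k := by gcongr
    have e3 : 2000 * (1 + α) * m ≤ α * C * m := by gcongr
    have e4 : α * (C * m) ≤ α * k := by gcongr
    have e5 : (0 : ℝ) ≤ (N + 1) * t := by positivity
    have e6 : 4 * (1 + α / 2) * (4 * (N + 1) * t + 1) ≤ α / 16 * k := by
      have e7 : 2000 * (1 + α) * 1 ≤ 2000 * (1 + α) * m := by gcongr
      have e8 : 0 ≤ α * (((N : ℝ) + 1) * t) := by positivity
      linarith
    calc 4 * (1 + α / 2) * p * (4 * (N + 1) * t + 1)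
        = p * (4 * (1 + α / 2) * (4 * (N + 1) * t + 1)) := by ring
      _ ≤ p * (α / 16 * k) := by gcongr
      _ = _ := by ring
  have n9 : 64 * Λ * ((N : ℝ) + 1) < α / 16 * p * k * s := by
    have e0 : 0 < Λ * ((N : ℝ) + 1) := by positivity
    have e1 : 2000 * (1 + α) * (Λ * ((N : ℝ) + 1)) ≤ α * C * (Λ * (N + 1)) := by gcongr
    have e2 : α * (C * (Λ * (N + 1))) ≤ α * (p * k * s) := by gcongr
    have e3 : 0 < α * (Λ * ((N : ℝ) + 1)) := by positivity
    linarith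
  let H : Fin t → Set (Finset V) := fun i => {E | E ⊆ K₂ ∧ E.card ≤ N + 1 ∧
    ∃ x ∈ Sa i, ∃ y ∈ Sb i,
      D.SignPathIn (fun j => σ (j + 1)) x N y (insert x (insert y E))}
  obtain ⟨g, hg, hgd⟩ := exists_disjoint_representatives H (N + 1) (fun i E hE => hE.2.1)
    fun A hA U hU => h.exists_connecting_interior hK hk hd₂ hSa₁ hSb₁ hSac hSbc hSad hSbd hSab hr
      hr' hrN n1 n2 n4 n5 n6 n7 n8 n9 σ hA hU
  choose hgK _ x hx y hy u hu0 huN huadj huinj humem using hg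
  let w : Fin t → ℕ → V := fun i j =>
    if j = 0 then a i else if j = N + 2 then b i else u i (j - 1)
  have hw : ∀ i j, 0 < j → j < N + 2 → w i j = u i (j - 1) := fun i j h0 hj => by
    simp only [w, h0.ne', hj.ne, if_false]
  have hmem : ∀ i j, 0 < j → j < N + 2 → w i j ∈ Sa i ∪ Sb i ∪ g i := fun i j h0 hj => by
    rw [hw i j h0 hj]
    have := humem i (j - 1) (by omega)
    simp only [Finset.mem_insert, Finset.mem_union] at this ⊢
    rcases this with h | h | h
    · exact Or.inl (Or.inl (h ▸ hx i))
    · exact Or.inl (Or.inr (h ▸ hy i))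
    · exact Or.inr h
  refine ⟨w, fun i => ⟨⟨by simp [w], by simp [w], ?_⟩, ?_, ?_, ?_⟩⟩
  · intro j hj
    rcases Nat.eq_zero_or_pos j with rfl | hj0
    · rw [hw i (0 + 1) (by omega) (by omega)]
      simp only [w, if_true, Nat.zero_add, Nat.sub_self, hu0]
      exact (mem_signNbhd.1 (hSa i (hx i))).2
    · rcases Nat.lt_or_ge j (N + 1) with hjN | hjN
      · rw [hw i j hj0 hj, hw i (j + 1) (by omega) (by omega)]
        have := huadj i (j - 1) (by omega)
        have e : j - 1 + 1 = j := by omega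
        simpa only [e, Nat.add_sub_cancel] using this
      · obtain rfl : j = N + 1 := by omega
        rw [hw i (N + 1) hj0 hj]
        have e : w i (N + 1 + 1) = b i := by simp [w]
        rw [e, Nat.add_sub_cancel, huN, ← signAdj_not]
        exact (mem_signNbhd.1 (hSb i (hy i))).2
  · intro j h0 hj
    have := hmem i j h0 hj
    simp only [Finset.mem_union] at this ⊢
    rcases this with (h | h) | h
    · exact Or.inl (hSa₁ i _ h)
    · exact Or.inl (hSb₁ i _ h)
    · exact Or.inr (hgK i h)
  · intro j h0 hj j' h0' hj' heq
    rw [hw i j h0 hj, hw i j' h0' hj'] at heq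
    have := huinj i (j - 1) (by omega) (j' - 1) (by omega) heq
    omega
  · intro i' hii' j h0 hj j' h0' hj' heq
    have e1 := hmem i j h0 hj
    have e2 := hmem i' j' h0' hj'
    rw [← heq] at e2
    have hK' : ∀ v ∈ K₁, v ∉ K₂ := fun v hv => Finset.disjoint_left.1 hK hv
    have f1 := fun v (hv : v ∈ _) => Finset.disjoint_left.1 (hSad i i' hii') hv
    have f2 := fun v (hv : v ∈ _) => Finset.disjoint_left.1 (hSbd i i' hii') hv
    have f3 := fun v (hv : v ∈ _) => Finset.disjoint_left.1 (hSab i i') hv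
    have f4 := fun v (hv : v ∈ _) => Finset.disjoint_left.1 (hSab i' i) hv
    have f5 := fun v (hv : v ∈ _) => Finset.disjoint_left.1 (hgd i i' hii') hv
    simp only [Finset.mem_union] at e1 e2
    rcases e1 with (e1 | e1) | e1 <;> rcases e2 with (e2 | e2) | e2
    · exact f1 _ e1 e2
    · exact f3 _ e1 e2
    · exact hK' _ (hSa₁ i _ e1) (hgK i' e2)
    · exact f4 _ e2 e1
    · exact f2 _ e1 e2
    · exact hK' _ (hSb₁ i _ e1) (hgK i' e2)
    · exact hK' _ (hSa₁ i' _ e2) (hgK i e1)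
    · exact hK' _ (hSb₁ i' _ e2) (hgK i e1)
    · exact f5 _ e1 e2

end LocallySparse

end Connecting

end Digraph

namespace Digraph

/-! ### The connecting lemma with explicit constants. -/

section Connecting

variable {V : Type*} {D : Digraph V}

namespace LocallySparse

variable {α p Λ m q : ℝ}

/-- The connecting lemma with all asymptotic assumptions replaced by explicit inequalities. -/
theorem exists_internallyDisjointWalks [Fintype V] [DecidableEq V]
    (h : D.LocallySparse α p Λ m q) {C δ : ℝ}
    {s N r t : ℕ} {a b : Fin t → V} (ha : Function.Injective a) (hb : Function.Injective b)
    {K : Finset V} (haK : ∀ i, a i ∉ K) (hbK : ∀ i, b i ∉ K)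
    (hdK : ∀ v ∈ K, (1 / 2 + α) * p * K.card ≤ (D.minSemidegInto v K : ℝ))
    (hdab : ∀ i, (1 / 2 + α) * p * K.card ≤ (D.minSemidegInto (a i) K : ℝ) ∧
      (1 / 2 + α) * p * K.card ≤ (D.minSemidegInto (b i) K : ℝ))
    (hδ : 0 < δ) (hδ' : δ ≤ 1 / 2) (hδα : (1 + δ) * (1 / 2 + 7 * α / 8) ≤ (1 - δ) * (1 / 2 + α))
    (hV : (2 * Fintype.card V + 1 : ℝ) * (2 * Real.exp (-(δ ^ 2 / 2 * (p * K.card / 2)))) < 1)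
    (hp2 : p ≤ 2) (hs1 : 1 ≤ s) (hsN : s ≤ N + 1)
    (hr : ∀ i < r, (2 : ℝ) ^ i ≤ m) (hr' : m ≤ (2 : ℝ) ^ r) (hrN : 2 * r + 2 ≤ N)
    (hC : 2000 * (1 + α) ≤ C) (hC' : 2000 * (1 + α) ≤ α * C)
    (h1 : 4 * C * (Λ * s) ≤ p * K.card) (h2 : 4 * C * m ≤ K.card)
    (h3 : 4 * C * (N + 1) ≤ p * K.card) (h4 : 4 * C * ((N + 1) * t) ≤ K.card)
    (h5 : 4 * C * (Λ * (N + 1)) ≤ p * K.card * s) (σ : Fin (N + 2) → Bool) :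
    ∃ P : Fin t → Fin (N + 2 + 1) → V,
      (∀ i, D.IsSignWalk σ (P i) ∧ P i 0 = a i ∧ P i (Fin.last (N + 2)) = b i ∧
        Set.range (P i) \ {a i, b i} ⊆ (K : Set V)) ∧
      InternallyDisjointWalks P := by
  have hα := h.α_pos
  have hp := h.p_pos
  have hΛ := h.Λ_pos
  have hm := h.one_le_m
  have hC0 : 0 < C := by linarith
  have hs1' : (1 : ℝ) ≤ s := by exact_mod_cast hs1
  have hK0 : (0 : ℝ) ≤ K.card := Nat.cast_nonneg _
  have hpK : 0 ≤ p * K.card := by positivity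
  have hαpK : 0 ≤ α * (p * K.card) := by positivity
  -- `P true` plays the role of `K₁` and `P false` that of `K₂`; `p ≤ 2` ensures that `K` itself has
  -- at least `p |K| / 2` vertices.
  obtain ⟨P, hPK, hPd, hPc, hPn⟩ := D.exists_split K (d := p * K.card / 2) hδ
    (by nlinarith) hV
  set κ : ℝ := (K.card : ℝ) with hκ
  set k : ℝ := ((P false).card : ℝ) with hk
  obtain ⟨hk1, hk2⟩ := hPc false
  have hkK : κ / 4 ≤ k := le_trans (by nlinarith) hk1
  have hpk : p * κ ≤ 4 * (p * k) := by
    have := mul_le_mul_of_nonneg_left hkK hp.le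
    linarith
  have hdeg : ∀ c v, (1 / 2 + α) * p * κ ≤ (D.minSemidegInto v K : ℝ) → ∀ τ,
      (1 - δ) / 2 * ((1 / 2 + α) * p * κ) ≤ ((D.signNbhd τ v (P c)).card : ℝ) := by
    intro c v hv τ
    have e1 : (1 / 2 + α) * p * κ ≤ ((D.signNbhd τ v K).card : ℝ) :=
      hv.trans (by exact_mod_cast minSemidegInto_le τ v K)
    refine le_trans ?_ (hPn c v τ (by linarith))
    exact mul_le_mul_of_nonneg_left e1 (by linarith)
  have hfirst : ∀ v, (1 / 2 + α) * p * κ ≤ (D.minSemidegInto v K : ℝ) → ∀ τ,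
      p * κ / 8 ≤ ((D.signNbhd τ v (P true)).card : ℝ) := by
    intro v hv τ
    refine le_trans ?_ (hdeg true v hv τ)
    have e1 : (1 / 4 : ℝ) * ((1 / 2 + α) * p * κ) ≤ (1 - δ) / 2 * ((1 / 2 + α) * p * κ) :=
      mul_le_mul_of_nonneg_right (by linarith) (by positivity)
    linarith
  have hinner : ∀ v ∈ P true ∪ P false, ∀ τ,
      (1 / 2 + 7 * α / 8) * p * k ≤ ((D.signNbhd τ v (P false)).card : ℝ) := by
    intro v hv τ
    have hvK : v ∈ K := by
      rcases Finset.mem_union.1 hv with hv | hv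
      · exact hPK _ hv
      · exact hPK _ hv
    refine le_trans ?_ (hdeg false v (hdK v hvK) τ)
    calc (1 / 2 + 7 * α / 8) * p * k ≤ (1 / 2 + 7 * α / 8) * p * ((1 + δ) / 2 * κ) := by gcongr
      _ = (1 + δ) * (1 / 2 + 7 * α / 8) * (p * κ / 2) := by ring
      _ ≤ (1 - δ) * (1 / 2 + α) * (p * κ / 2) := by gcongr
      _ = _ := by ring
  have hst : (s : ℝ) * t ≤ (N + 1) * t := by
    have : (s : ℝ) ≤ N + 1 := by exact_mod_cast hsN
    gcongr
  obtain ⟨w, hw⟩ := h.exists_walks (C := C) (k := k) (d₁ := p * κ / 8) (s := s) (N := N) ha hb hPd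
    le_rfl (fun i => hfirst _ (hdab i).1) (fun i => hfirst _ (hdab i).2) hinner hs1
    (by
      have : 16 * (Λ * s) ≤ C * (Λ * s) := by gcongr; linarith
      linarith)
    (by
      have e1 : 16 * (1 + α / 2) * ((s : ℝ) * t) ≤ C * ((N + 1) * t) := by
        gcongr; linarith
      have e2 := mul_le_mul_of_nonneg_left (show 64 * (1 + α / 2) * ((s : ℝ) * t) ≤ κ by linarith)
        hp.le
      linarith)
    hr hr' hrN hC hC'
    (by
      have : C * (Λ * 1) ≤ C * (Λ * s) := by gcongr
      linarith)
    (by linarith) (by linarith) (by linarith)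
    (by
      have := mul_le_mul_of_nonneg_right hpk (show (0 : ℝ) ≤ s by positivity)
      linarith)
    (fun j => if hj : j < N + 2 then σ ⟨j, hj⟩ else true)
  have hmem : ∀ i j, 0 < j → j < N + 2 → w i j ∈ K := fun i j h0 hj => by
    rcases Finset.mem_union.1 ((hw i).2.1 j h0 hj) with hv | hv
    · exact hPK _ hv
    · exact hPK _ hv
  have hend : ∀ i j, j = 0 ∨ j = N + 2 → w i j ∉ K := by
    rintro i j (rfl | rfl)
    · rw [(hw i).1.1]; exact haK i
    · rw [(hw i).1.2.1]; exact hbK i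
  refine ⟨fun i j => w i j, fun i => ⟨⟨?_, ?_⟩, (hw i).1.1, (hw i).1.2.1, ?_⟩, ?_⟩
  · intro j
    have := (hw i).1.2.2 j j.isLt
    simpa [j.isLt] using this
  · intro j j' hjj' heq
    simp only at heq
    have hlt : (j : ℕ) < j' := hjj'
    have hj' := j'.isLt
    have key : (j : ℕ) = 0 ∧ (j' : ℕ) = N + 2 := by
      rcases Nat.eq_zero_or_pos (j : ℕ) with h0 | h0
      · refine ⟨h0, ?_⟩
        by_contra hne
        have := hmem i j' (by omega) (by omega)
        rw [← heq] at this
        exact hend i j (Or.inl h0) this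
      · exfalso
        have hm1 := hmem i j h0 (by omega)
        by_cases hlast : (j' : ℕ) = N + 2
        · rw [heq] at hm1
          exact hend i j' (Or.inr hlast) hm1
        · have := (hw i).2.2.1 j h0 (by omega) j' (by omega) (by omega) heq
          omega
    exact ⟨Fin.ext key.1, Fin.ext key.2⟩
  · rintro v ⟨⟨j, rfl⟩, hv⟩
    simp only [Set.mem_insert_iff, Set.mem_singleton_iff, not_or] at hv
    have hj' := j.isLt
    refine hmem i j (Nat.pos_of_ne_zero fun h0 => hv.1 ?_) ?_
    · simp only [h0]; exact (hw i).1.1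
    · have : (j : ℕ) ≠ N + 2 := fun h0 => hv.2 (by simp only [h0]; exact (hw i).1.2.1)
      omega
  · intro i i' hii' j j' hj0 hjl heq
    have h0 : 0 < (j : ℕ) := Nat.pos_of_ne_zero fun h0 => hj0 (Fin.ext h0)
    have hl : (j : ℕ) < N + 2 := by
      have := j.isLt
      have : (j : ℕ) ≠ N + 2 := fun h0 => hjl (Fin.ext h0)
      omega
    have hj' := j'.isLt
    simp only at heq
    have hmj := hmem i j h0 hl
    rw [heq] at hmj
    have h0' : 0 < (j' : ℕ) := Nat.pos_of_ne_zero fun h0 => hend i' j' (Or.inl h0) hmj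
    have hl' : (j' : ℕ) < N + 2 := by
      have : (j' : ℕ) ≠ N + 2 := fun h0 => hend i' j' (Or.inr h0) hmj
      omega
    exact (hw i).2.2.2 i' hii' j h0 hl j' h0' hl' heq

end LocallySparse

/-! ### Parameters of pseudorandom digraphs and estimates for large `n`. -/

theorem IsPseudorandom.le_two [Fintype V] {n : ℕ} {α p : ℝ} (hD : D.IsPseudorandom n α p)
    (hα : 0 < α) (hp : 0 < p) (hn : 0 < n) : p ≤ 2 := by
  obtain ⟨v⟩ : Nonempty V := Fintype.card_pos_iff.1 (hD.card_eq ▸ hn)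
  have h1 := hD.min_semideg v
  have h2 : D.minSemidegInto v Finset.univ ≤ n := by
    rw [← hD.card_eq]
    exact (minSemidegInto_le true v _).trans (Finset.card_le_univ _)
  have h2' : (D.minSemidegInto v Finset.univ : ℝ) ≤ n := by exact_mod_cast h2
  have hn' : (0 : ℝ) < n := by exact_mod_cast hn
  have h3 : 0 ≤ α * (n * p) := by positivity
  have h4 : (n : ℝ) * p ≤ n * 2 := by linarith
  exact le_of_mul_le_mul_left h4 hn'

theorem IsPseudorandom.locallySparse [Fintype V] {n : ℕ} {α p : ℝ}
    (hD : D.IsPseudorandom n α p) (hα : 0 < α) (hp : 0 < p) (hp2 : p ≤ 2)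
    (hL : 2 ≤ Real.log n) (hL' : 16 ≤ Real.log n ^ (0.9 : ℝ)) :
    D.LocallySparse α p (Real.log n ^ (2.1 : ℝ)) (Real.log n ^ (1.1 : ℝ) / p)
      (Real.log n ^ 2 / p) where
  α_pos := hα
  p_pos := hp
  Λ_pos := Real.rpow_pos_of_pos (by linarith) _
  one_le_m := by
    rw [le_div_iff₀ hp]
    have := Real.self_le_rpow_of_one_le (show 1 ≤ Real.log n by linarith)
      (show (1 : ℝ) ≤ 1.1 by norm_num)
    linarith
  m_le_q := by
    have h0 : 0 < Real.log n := by linarith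
    rw [mul_div_assoc']
    gcongr
    calc 16 * Real.log n ^ (1.1 : ℝ) ≤ Real.log n ^ (0.9 : ℝ) * Real.log n ^ (1.1 : ℝ) := by
          gcongr
      _ = Real.log n ^ 2 := by
          rw [← Real.rpow_add h0, ← Real.rpow_natCast]; norm_num
  within := hD.few_arcs_within
  between := hD.arcs_between

/-- The number of doublings needed to reach `m`. -/
theorem exists_pow_two_near {m L : ℝ} {n : ℕ} (hL : L = Real.log n) (hL1 : 1 ≤ L)
    (hmn : m ≤ n) :
    ∃ r : ℕ, (∀ i < r, (2 : ℝ) ^ i ≤ m) ∧ m ≤ (2 : ℝ) ^ r ∧ (r : ℝ) ≤ 1 + 3 / 2 * L := by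
  have hex : ∃ r : ℕ, m ≤ (2 : ℝ) ^ r := (pow_unbounded_of_one_lt m one_lt_two).imp
    fun _ => le_of_lt
  classical
  have hlt : ∀ i < Nat.find hex, (2 : ℝ) ^ i ≤ m := fun i hi =>
    (not_le.1 (Nat.find_min hex hi)).le
  refine ⟨Nat.find hex, hlt, Nat.find_spec hex, ?_⟩
  rcases Nat.eq_zero_or_pos (Nat.find hex) with h0 | h0
  · rw [h0]; push_cast; linarith
  · obtain ⟨r, hr⟩ : ∃ r, Nat.find hex = r + 1 := ⟨Nat.find hex - 1, by omega⟩
    have h1 : (2 : ℝ) ^ r ≤ n := (hlt r (by omega)).trans hmn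
    have h2 := Real.log_le_log (by positivity) h1
    rw [Real.log_pow, ← hL] at h2
    have h3 := Real.log_two_gt_d9
    rw [hr]; push_cast
    have h4 : (r : ℝ) * (2 / 3) ≤ r * Real.log 2 := by gcongr; linarith
    linarith

theorem union_bound_lt_one {n : ℕ} {L x : ℝ} (hL : L = Real.log n) (hL1 : 1 ≤ L) (hn : 1 ≤ n)
    (hx : 10 * L ≤ x) : (2 * n + 1 : ℝ) * (2 * Real.exp (-x)) < 1 := by
  have hn' : (1 : ℝ) ≤ n := by exact_mod_cast hn
  have h1 : Real.exp L = n := by rw [hL, Real.exp_log (by linarith)]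
  have h2 : Real.exp (-x) ≤ Real.exp (-(10 * L)) := Real.exp_le_exp.2 (by linarith)
  have h3 : (6 : ℝ) < Real.exp L * Real.exp L * Real.exp L := by
    have := Real.add_one_le_exp L
    nlinarith [mul_self_nonneg (Real.exp L - 2)]
  have h4 : Real.exp L * Real.exp L * Real.exp L * Real.exp L ≤ Real.exp (10 * L) := by
    rw [← Real.exp_add, ← Real.exp_add, ← Real.exp_add, Real.exp_le_exp]; linarith
  have h5 : (6 : ℝ) * n < Real.exp (10 * L) := by
    refine lt_of_lt_of_le ?_ h4
    rw [← h1]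
    exact mul_lt_mul_of_pos_right h3 (Real.exp_pos L)
  calc (2 * n + 1 : ℝ) * (2 * Real.exp (-x)) ≤ 6 * n * Real.exp (-(10 * L)) := by
        nlinarith [Real.exp_pos (-x)]
    _ < Real.exp (10 * L) * Real.exp (-(10 * L)) := by gcongr
    _ = 1 := by rw [← Real.exp_add]; simp

end Connecting

end Digraph
theorem mainTheorem3 (α : ℝ) (hα : 0 < α)
    (p : ℕ → ℝ)
    (hp : Tendsto (fun n : ℕ => p n / (Real.log n ^ 8 / n)) atTop atTop)
    (f : ℕ → ℝ) (hf : Tendsto f atTop atTop) :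
    ∀ᶠ n : ℕ in atTop,
      ∀ (V : Type*) [Fintype V] (D : Digraph V), D.IsPseudorandom n α (p n) →
      ∀ ℓ t : ℕ, 10 * Real.log n ≤ ℓ → 4 * Real.log n ^ 2 / p n ≤ t →
      ∀ a b : Fin t → V, Function.Injective a → Function.Injective b →
      ∀ K : Finset V, (∀ i, a i ∉ K) → (∀ i, b i ∉ K) →
        f n * (t * ℓ) ≤ K.card →
        (∀ v ∈ K, (1 / 2 + α) * p n * K.card ≤ (D.minSemidegInto v K : ℝ)) →
        (∀ i, (1 / 2 + α) * p n * K.card ≤ (D.minSemidegInto (a i) K : ℝ) ∧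
          (1 / 2 + α) * p n * K.card ≤ (D.minSemidegInto (b i) K : ℝ)) →
      ∀ σ : Fin ℓ → Bool,
        ∃ P : Fin t → Fin (ℓ + 1) → V,
          (∀ i, D.IsSignWalk σ (P i) ∧ P i 0 = a i ∧ P i (Fin.last ℓ) = b i ∧
            Set.range (P i) \ {a i, b i} ⊆ (K : Set V)) ∧
          InternallyDisjointWalks P := by
  -- The two factors make both `C` and `α * C` at least `2000 * (1 + α)`.
  set C : ℝ := 2000 * (1 + α) * (1 + 1 / α) with hCdef
  have hC : 2000 * (1 + α) ≤ C := by
    have : 0 ≤ 2000 * (1 + α) * (1 / α) := by positivity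
    rw [hCdef, mul_add]; linarith
  have hC' : 2000 * (1 + α) ≤ α * C := by
    have e : α * C = 2000 * (1 + α) * α + 2000 * (1 + α) := by
      rw [hCdef]; field_simp
    have : 0 ≤ 2000 * (1 + α) * α := by positivity
    linarith
  -- This value gives equality in `hδα`.
  set δ : ℝ := α / (8 + 15 * α) with hδdef
  have hδ : 0 < δ := by positivity
  have hδ' : δ ≤ 1 / 2 := by
    rw [hδdef, div_le_iff₀ (by positivity)]; linarith
  have hδα : (1 + δ) * (1 / 2 + 7 * α / 8) ≤ (1 - δ) * (1 / 2 + α) := by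
    have : δ * (8 + 15 * α) = α := div_mul_cancel₀ _ (by positivity)
    linarith
  have hlog : Tendsto (fun n : ℕ => Real.log n) atTop atTop :=
    Real.tendsto_log_atTop.comp tendsto_natCast_atTop_atTop
  filter_upwards [hp.eventually_ge_atTop 1, hf.eventually_ge_atTop (4 * C),
    hf.eventually_ge_atTop (1 / δ ^ 2), hlog.eventually_ge_atTop 4,
    ((tendsto_rpow_atTop (show (0 : ℝ) < 0.9 by norm_num)).comp hlog).eventually_ge_atTop 16,
    eventually_ge_atTop 1] with n hpn hfC hfδ hL4 hL16 hn1
  intro V _ D hD ℓ t hℓ ht a b ha hb K haK hbK hK hdK hdab σ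
  classical
  set L := Real.log n with hL
  have hn0 : (0 : ℝ) < n := by exact_mod_cast hn1
  have hL0 : 0 < L := by linarith
  have hpL : L ^ 8 / n ≤ p n := by rwa [le_div_iff₀ (by positivity), one_mul] at hpn
  have hp0 : 0 < p n := lt_of_lt_of_le (by positivity) hpL
  have hp2 := hD.le_two hα hp0 hn1
  have hsp := hD.locallySparse hα hp0 hp2 (by linarith) hL16
  set q := p n with hq
  -- With `m ≤ n`, the number `r` of doublings is at most `1 + 3 L / 2`, so the two sides fit into
  -- `ℓ ≥ 10 L` arcs.
  have hmn : L ^ (1.1 : ℝ) / q ≤ n := by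
    rw [div_le_iff₀ hp0]
    have e1 : L ^ (1.1 : ℝ) ≤ L ^ (8 : ℝ) :=
      Real.rpow_le_rpow_of_exponent_le (by linarith) (by norm_num)
    have e2 : L ^ (8 : ℝ) = L ^ 8 := by exact_mod_cast Real.rpow_natCast L 8
    have e3 : L ^ 8 ≤ q * n := by rwa [div_le_iff₀ hn0] at hpL
    exact e1.trans (e2.le.trans (e3.trans_eq (mul_comm _ _)))
  obtain ⟨r, hr, hr', hrL⟩ := Digraph.exists_pow_two_near hL (by linarith) hmn
  have hℓr : 2 * r + 4 ≤ ℓ := by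
    have : (2 * r + 4 : ℝ) ≤ ℓ := by linarith
    exact_mod_cast this
  obtain ⟨N, rfl⟩ : ∃ N, ℓ = N + 2 := ⟨ℓ - 2, by omega⟩
  have hroot1 : 1 ≤ L ^ (0.5 : ℝ) := Real.one_le_rpow (by linarith) (by norm_num)
  -- Stars must have at least about `L ^ 0.1` leaves, since `Λ = L ^ 2.1` while `q |K|` is only
  -- guaranteed a factor `L ^ 2` times `ℓ`; and `Λ s` may not exceed about `L ^ 3`. A size of order
  -- `L ^ 0.5` meets both.
  obtain ⟨s, hs_ge, hs_le⟩ : ∃ s : ℕ, L ^ (0.5 : ℝ) ≤ s ∧ (s : ℝ) ≤ 2 * L ^ (0.5 : ℝ) :=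
    ⟨⌈L ^ (0.5 : ℝ)⌉₊, Nat.le_ceil _,
      (Nat.ceil_lt_add_one (zero_le_one.trans hroot1)).le.trans (by linarith)⟩
  have hs1 : 1 ≤ s := by
    have : (1 : ℝ) ≤ s := hroot1.trans hs_ge
    exact_mod_cast this
  have hrootL : L ^ (0.5 : ℝ) ≤ L := Real.rpow_le_self_of_one_le (by linarith) (by norm_num)
  have hC0 : 0 < C := by linarith
  have hN : 10 * L ≤ (N : ℝ) + 2 := by exact_mod_cast hℓ
  have hN0 : (0 : ℝ) ≤ N := Nat.cast_nonneg N
  have hsN : s ≤ N + 1 := by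
    have : (s : ℝ) ≤ N + 1 := by linarith
    exact_mod_cast this
  have hΛ0 : 0 < L ^ (2.1 : ℝ) := hsp.Λ_pos
  push_cast at hK
  have ht' : 4 * L ^ 2 ≤ t * q := by rwa [div_le_iff₀ hp0] at ht
  have hqK : 4 * f n * L ^ 2 * (N + 2) ≤ q * K.card := by
    have hf0 : 0 ≤ f n := by linarith
    calc 4 * f n * L ^ 2 * (N + 2) = f n * (N + 2) * (4 * L ^ 2) := by ring
      _ ≤ f n * (N + 2) * (t * q) := by gcongr
      _ = q * (f n * (t * (N + 2))) := by ring
      _ ≤ q * K.card := by gcongr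
  have hLsq : 1 ≤ L ^ 2 := one_le_pow₀ (by linarith)
  have hqK' : 4 * C * (L ^ 2 * (N + 2)) ≤ q * K.card := by
    refine le_trans ?_ hqK
    have : 4 * C * (L ^ 2 * (N + 2)) ≤ f n * (L ^ 2 * (N + 2)) := by gcongr
    have : 0 ≤ f n * (L ^ 2 * (N + 2)) := by
      have hf0 : 0 ≤ f n := by linarith
      positivity
    linarith
  refine hsp.exists_internallyDisjointWalks (C := C) (δ := δ) (s := s) (r := r) ha hb haK hbK hdK
    hdab hδ hδ' hδα ?_ hp2 hs1 hsN hr hr' (by omega) hC hC' ?_ ?_ ?_ ?_ ?_ σ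
  · rw [hD.card_eq]
    refine Digraph.union_bound_lt_one hL (by linarith) hn1 ?_
    have e1 : 1 ≤ δ ^ 2 * f n := by rwa [div_le_iff₀' (by positivity)] at hfδ
    calc 10 * L ≤ 1 * (1 * (N + 2)) := by linarith
      _ ≤ δ ^ 2 * f n * (L ^ 2 * (N + 2)) := by gcongr
      _ = δ ^ 2 / 2 * (4 * f n * L ^ 2 * (N + 2) / 2) := by ring
      _ ≤ δ ^ 2 / 2 * (q * K.card / 2) := by gcongr
  · refine le_trans ?_ hqK'
    have e1 : L ^ (2.1 : ℝ) * s ≤ L ^ 2 * (N + 2) := by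
      calc L ^ (2.1 : ℝ) * s ≤ L ^ (2.1 : ℝ) * (2 * L ^ (0.5 : ℝ)) := by gcongr
        _ = 2 * L ^ (2.6 : ℝ) := by
          rw [show (2.6 : ℝ) = 2.1 + 0.5 by norm_num, Real.rpow_add hL0]; ring
        _ ≤ 2 * L ^ (3 : ℝ) := by
          gcongr
          · linarith
          · norm_num
        _ = L ^ 2 * (2 * L) := by
          have e2 : L ^ (3 : ℝ) = L ^ 3 := by exact_mod_cast Real.rpow_natCast L 3
          rw [e2]; ring
        _ ≤ L ^ 2 * (N + 2) := by gcongr; linarith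
    gcongr
  · rw [mul_div_assoc', div_le_iff₀ hp0]
    calc 4 * C * L ^ (1.1 : ℝ) ≤ 4 * C * L ^ (2 : ℝ) := by
          gcongr
          · linarith
          · norm_num
      _ = 4 * C * (L ^ 2 * 1) := by rw [mul_one]; norm_num
      _ ≤ 4 * C * (L ^ 2 * (N + 2)) := by gcongr; linarith
      _ ≤ K.card * q := by rw [mul_comm (K.card : ℝ)]; exact hqK'
  · refine le_trans ?_ hqK'
    gcongr
    nlinarith
  · refine le_trans ?_ hK
    have : ((N : ℝ) + 1) * t ≤ t * (N + 2) := by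
      rw [mul_comm]; gcongr; norm_num
    have hf0 : 0 ≤ f n := by linarith
    gcongr
  · calc 4 * C * (L ^ (2.1 : ℝ) * (N + 1)) ≤ 4 * C * (L ^ (2.5 : ℝ) * (N + 2)) := by
          gcongr
          · linarith
          · norm_num
          · norm_num
      _ = 4 * C * (L ^ 2 * (N + 2)) * L ^ (0.5 : ℝ) := by
          rw [show (2.5 : ℝ) = 2 + 0.5 by norm_num, Real.rpow_add hL0, Real.rpow_two]; ring
      _ ≤ q * K.card * s := mul_le_mul hqK' hs_ge (by positivity) (by positivity)
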